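/- Let $a,b\in\mathbb{C}$, $0<\lambda<\infty$, $0<\theta<\min\{\pi,\pi/\lambda\}$ and $\mu<1$. Let $f$ be an entire function such that, as $|z|\to\infty$, $$f(z)=z^a(\log z)^b\exp(z^\lambda)\,(1+o(1))\quad\text{uniformly for }|\arg z|\le\theta,\qquad f(z)=O\bigl(\exp(\mu|z|^\lambda)\bigr)\quad\text{uniformly for }|\arg z|>\theta,$$ with principal branches (in particular $f$ has order $\lambda$). Let $p_n(z)=\sum_{k=0}^n \frac{f^{(k)}(0)}{k!}z^k$, $r_n=(n/\lambda)^{1/\lambda}$ and $\varphi(z)=(z^\lambda-1-\log z^\lambda)/\lambda$. Let $\Delta$ be the largest circle centred at $1$ contained in the closed sector $|\arg z|\le\theta$ (its radius is $\sin\theta$ if $\theta\le\pi/2$, and $1$ otherwise), and let $\sigma_1,\sigma_2=\overline{\sigma_1}$ be the points where $\Delta$ meets the line of steepest descent of $\operatorname{Re}\varphi$ through its saddle point $z=1$. Suppose that there is a constant $0<\nu<-\operatorname{Re}\varphi(\sigma_1)$ such that, for every compact $K\subset\{z\ne0:|\arg z|\le\theta\}$, $$\frac{f'(r_nz)}{f(r_nz)}=O(e^{\nu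 n})\quad\text{uniformly for }z\in K\text{ as }n\to\infty .$$ Then $$\lim_{n\to\infty}\frac{p_{n-1}\bigl(r_n(1+w/\sqrt n)\bigr)}{f\bigl(r_n(1+w/\sqrt n)\bigr)}=\frac12\operatorname{erfc}\bigl(w\sqrt{\lambda/2}\bigr)$$ uniformly on every compact subset of $\operatorname{Re}w<0$, where $\operatorname{erfc}(z)=\frac{2}{\sqrt\pi}\int_z^{z+\infty}e^{-s^2}\,ds$ (integration along the horizontal half-line to the right of $z$). Consequently the property in part (b) of the modified Width Conjecture of Edrei, Saff and Varga holds for $f$ at the argument $0$ with $m=2$, $\rho_n=r_n$ and all positive integers $n$ as indices: $r_n>0$, $r_n\to\infty$, $r_n=O(n^{2/(\lambda m)})=O(n^{1/\lambda})$, and for every fixed $\epsilon>0$ the number of (distinct) zeros of $p_n$ in the disk $|z-r_n|\le r_n n^{-1/2+\epsilon}$ tends to infinity as $n\to\infty$. -/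

import Mathlib

open Filter Topology Asymptotics Bornology

noncomputable section

namespace PartialSums

/-- The `n`-th partial sum `∑_{k ≤ n} f⁽ᵏ⁾(0) / k! * z ^ k` of the Maclaurin series of `f`. -/
def partialSum (f : ℂ → ℂ) (n : ℕ) (z : ℂ) : ℂ :=
  ∑ k ∈ Finset.range (n + 1), iteratedDeriv k f 0 / (k.factorial : ℂ) * z ^ k

/-- The complementary error function `2 / √π * ∫_z^{z + ∞} exp (-s ^ 2) ds`, the integral being
taken over the horizontal half-line `s = z + t`, `t > 0`. -/
def erfc (z : ℂ) : ℂ :=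
  (2 / (Real.sqrt Real.pi : ℂ)) * ∫ t in Set.Ioi (0 : ℝ), Complex.exp (-(z + (t : ℂ)) ^ 2)

/-- `r_n = (n / lam) ^ (1 / lam)`. -/
def scale (lam : ℝ) (n : ℕ) : ℝ := ((n : ℝ) / lam) ^ (1 / lam)

/-- The closed sector `|arg z| ≤ θ` with the origin removed. -/
def sector (θ : ℝ) : Set ℂ := {z | z ≠ 0 ∧ |z.arg| ≤ θ}

/-- The asymptotic behaviour of `f` as `|z| → ∞`: it is
`z ^ a * (log z) ^ b * exp (z ^ lam) * (1 + o(1))`, uniformly in `|arg z| ≤ θ`, and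
`O (exp (μ * |z| ^ lam))`, uniformly in `|arg z| > θ`. Powers and logarithm are principal. -/
def HasSectorGrowth (f : ℂ → ℂ) (a b : ℂ) (lam θ μ : ℝ) : Prop :=
  (f ~[cobounded ℂ ⊓ 𝓟 {z : ℂ | |z.arg| ≤ θ}]
    fun z : ℂ => z ^ a * Complex.log z ^ b * Complex.exp (z ^ (lam : ℂ))) ∧
  (f =O[cobounded ℂ ⊓ 𝓟 {z : ℂ | θ < |z.arg|}]
    fun z : ℂ => Real.exp (μ * ‖z‖ ^ lam))

/-- The phase function `φ(z) = (z ^ lam - 1 - log (z ^ lam)) / lam`. -/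
def phase (lam : ℝ) (z : ℂ) : ℂ :=
  (z ^ (lam : ℂ) - 1 - Complex.log (z ^ (lam : ℂ))) / (lam : ℂ)

/-- The line of steepest descent of `Re φ` through its saddle point `1`, inside the sector
`|arg z| ≤ θ`. On it `Im φ = Im φ(1) = 0` and `Re φ ≤ Re φ(1) = 0`; the rest of the level set
`Im φ = 0` is the positive real axis, the line of steepest ascent, where `Re φ > 0` off `1`. -/
def steepestDescent (lam θ : ℝ) : Set ℂ :=
  {z | z ∈ sector θ ∧ (phase lam z).im = 0 ∧ (phase lam z).re ≤ 0}

/-- The radius of the largest circle centred at `1` that lies in the closed sector `|arg z| ≤ θ`: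
it is `sin θ` (tangency to the two bounding rays) for `θ ≤ π / 2`, and `1` for larger `θ`. -/
def circleRadius (θ : ℝ) : ℝ := Real.sin (min θ (Real.pi / 2))

/-- The growth condition on `f' / f`: there is `0 < ν < - Re φ(σ)` such that
`f'(r_n z) / f(r_n z) = O (exp (ν n))` as `n → ∞`, uniformly for `z` in any given compact subset
of the sector. Here `σ` is one of the two (complex conjugate) points where the circle meets the
line of steepest descent; `Re φ` is the same at both. -/
def LogDerivGrowth (f : ℂ → ℂ) (lam θ : ℝ) : Prop :=
  ∃ σ ∈ steepestDescent lam θ ∩ Metric.sphere (1 : ℂ) (circleRadius θ),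
    ∃ ν : ℝ, 0 < ν ∧ ν < -(phase lam σ).re ∧
      ∀ K : Set ℂ, IsCompact K → K ⊆ sector θ →
        ∃ C : ℝ, ∀ᶠ n : ℕ in atTop, ∀ z ∈ K,
          ‖deriv f ((scale lam n : ℂ) * z) / f ((scale lam n : ℂ) * z)‖
            ≤ C * Real.exp (ν * (n : ℝ))

/-- The property that part (b) of the modified Width Conjecture asks for at the argument `θ`, for
an entire function `f` of order `lam`, with the infinite set of indices `N`, the integer `m ≥ 2`
and the sequence `ρ`: `ρ n > 0`, `ρ n → ∞`, `ρ n = O (n ^ (2 / (lam * m)))`, and for every `ε > 0`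
the number of (distinct) zeros of the `n`-th partial sum in the disk
`|z - ρ n * exp (i θ)| ≤ ρ n * n ^ (-1 / m + ε)` tends to infinity, as `n → ∞` through `N`. -/
def WidthPartB (f : ℂ → ℂ) (lam θ : ℝ) (m : ℕ) (N : Set ℕ) (ρ : ℕ → ℝ) : Prop :=
  N.Infinite ∧ 2 ≤ m ∧ (∀ n ∈ N, 0 < n ∧ 0 < ρ n) ∧
  Tendsto ρ (atTop ⊓ 𝓟 N) atTop ∧
  (ρ =O[atTop ⊓ 𝓟 N] fun n : ℕ => (n : ℝ) ^ (2 / (lam * (m : ℝ)))) ∧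
  ∀ ε : ℝ, 0 < ε →
    Tendsto
      (fun n : ℕ => Set.ncard {z : ℂ | partialSum f n z = 0 ∧
        ‖z - (ρ n : ℂ) * Complex.exp (Complex.I * (θ : ℂ))‖
          ≤ ρ n * (n : ℝ) ^ (-1 / (m : ℝ) + ε)})
      (atTop ⊓ 𝓟 N) atTop

end PartialSums

end

/-!
# Partial sums of entire functions with simple exponential growth

Write `G n = r_n ^ a * (log r_n) ^ b * exp (n / lam)` (`modelAtScale`). The growth of `f` enters
only through two facts, about a neighbourhood of `r_n` and about the circle `|z| = r_n`.

* Near `r_n`, in the coordinate `z = r_n * exp (u / √n)`, the quotient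
  `f z * (z / r_n) ^ (-n) / G n` tends to `exp (lam * u ^ 2 / 2)` (`tendsto_local`): since
  `r_n ^ lam = n / lam`, the exponent `z ^ lam - n * log (z / r_n)` has a saddle point at `u = 0`.
* On the whole circle, `|f (r_n * exp (i t))| ≤ C * |G n| * exp (-c * n * t ^ 2)`
  (`norm_le_gaussian`). In the sector this is `cos (lam * t) ≤ 1 - 2 (lam * t) ^ 2 / π ^ 2`, valid
  because `lam * θ < π`; outside it, `f` is exponentially smaller than `G n` because `μ < 1`.

For `|z| < r_n`, Cauchy's formula gives
`f z - p_{n-1} z = (2 π i)⁻¹ ∮ (z / s) ^ n * f s / (s - z) ds` over `|s| = r_n`. Take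
`z = r_n * exp (u / √n)` with `Re u < 0` and `s = r_n * exp (i τ / √n)`, and divide by `f z`.
By dominated convergence, the right-hand side tends to
`(2 π)⁻¹ ∫ exp (-lam * (τ ^ 2 + u ^ 2) / 2) / (i τ - u) dτ`, which is
`erfc (-u * √(lam / 2)) / 2` (`integral_gaussian_div`, `tendsto_remainder`). Now
`erfc z + erfc (-z) = 2` gives the limit of `p_{n-1} / f`. All limits are taken along a general
filter, with `u` allowed to vary; with the filter `atTop ×ˢ 𝓝 w₀` they say that the convergence is
locally uniform.

For the zeros, `erfc` has infinitely many zeros in the left half-plane (`infinite_zeros_erfc`): in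
the right half-plane `erfc u` is close to `exp (-u ^ 2) / (√π * u)`, and near suitable points on the
diagonal `arg u = π / 4` it looks like `2 * exp (-t)` in a local coordinate `t`, so that it takes the
value `2` there. Each zero of the limit attracts zeros of the rescaled partial sums
(`eventually_exists_zero`), at distance `O (r_n / √n)` from `r_n`.
-/

namespace PartialSums

/-! ### The scale `r_n` and the model function near the circle `|z| = r_n` -/

lemma scale_pos {lam : ℝ} (hlam : 0 < lam) {n : ℕ} (hn : 0 < n) : 0 < scale lam n :=
  Real.rpow_pos_of_pos (div_pos (Nat.cast_pos.2 hn) hlam) _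

lemma scale_rpow {lam : ℝ} (hlam : 0 < lam) (n : ℕ) : scale lam n ^ lam = n / lam := by
  rw [scale, ← Real.rpow_mul (by positivity), one_div_mul_cancel hlam.ne', Real.rpow_one]

lemma tendsto_scale {lam : ℝ} (hlam : 0 < lam) : Tendsto (scale lam) atTop atTop :=
  (tendsto_rpow_atTop (one_div_pos.2 hlam)).comp
    (tendsto_natCast_atTop_atTop.atTop_div_const hlam)

/-- The size `r_n ^ a * (log r_n) ^ b * exp (n / lam)` of the model
`z ^ a * (log z) ^ b * exp (z ^ lam)` at the point `z = r_n`. -/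
noncomputable def modelAtScale (a b : ℂ) (lam : ℝ) (n : ℕ) : ℂ :=
  (scale lam n : ℂ) ^ a * (Real.log (scale lam n) : ℂ) ^ b * Complex.exp ((n / lam : ℝ) : ℂ)

lemma modelAtScale_ne_zero (a b : ℂ) {lam : ℝ} {n : ℕ} (h : 1 < scale lam n) :
    modelAtScale a b lam n ≠ 0 := by
  have h0 : 0 < scale lam n := one_pos.trans h
  have hL : 0 < Real.log (scale lam n) := Real.log_pos h
  refine mul_ne_zero (mul_ne_zero ?_ ?_) (Complex.exp_ne_zero _)
  · simp [Complex.cpow_eq_zero_iff, h0.ne']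
  · rw [Ne, Complex.cpow_eq_zero_iff]
    push Not
    intro h
    exact absurd (Complex.ofReal_eq_zero.1 h) hL.ne'

/-- The model function in logarithmic coordinates `z = r * exp x`. -/
lemma model_mul_exp (a b : ℂ) (lam : ℝ) {r : ℝ} (hr : 1 < r) {x : ℂ}
    (h1 : -Real.pi < x.im) (h2 : x.im ≤ Real.pi) (h3 : 1 + x / (Real.log r : ℂ) ≠ 0) :
    (r * Complex.exp x : ℂ) ^ a * Complex.log (r * Complex.exp x) ^ b *
        Complex.exp ((r * Complex.exp x : ℂ) ^ (lam : ℂ)) =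
      (r : ℂ) ^ a * (Real.log r : ℂ) ^ b * (Complex.exp (a * x) *
        (1 + x / (Real.log r : ℂ)) ^ b *
        Complex.exp (((r ^ lam : ℝ) : ℂ) * Complex.exp (lam * x))) := by
  have h0 : 0 < r := one_pos.trans hr
  have hL : 0 < Real.log r := Real.log_pos hr
  have hLc : (Real.log r : ℂ) ≠ 0 := Complex.ofReal_ne_zero.2 hL.ne'
  have hrc : (r : ℂ) ≠ 0 := Complex.ofReal_ne_zero.2 h0.ne'
  have hz : (r * Complex.exp x : ℂ) ≠ 0 := mul_ne_zero hrc (Complex.exp_ne_zero _)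
  have hlog : Complex.log (r * Complex.exp x) = Real.log r + x := by
    rw [Complex.log_ofReal_mul h0 (Complex.exp_ne_zero _), Complex.log_exp h1 h2]
  have hpow (c : ℂ) : (r * Complex.exp x : ℂ) ^ c = (r : ℂ) ^ c * Complex.exp (c * x) := by
    rw [Complex.cpow_def_of_ne_zero hz, hlog, Complex.cpow_def_of_ne_zero hrc,
      ← Complex.ofReal_log h0.le, ← Complex.exp_add]
    ring_nf
  have hlogb : Complex.log (r * Complex.exp x) ^ b =
      (Real.log r : ℂ) ^ b * (1 + x / (Real.log r : ℂ)) ^ b := by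
    have e : Complex.log (r * Complex.exp x) =
        (Real.log r : ℂ) * (1 + x / (Real.log r : ℂ)) := by
      rw [hlog]; field_simp
    rw [e, Complex.cpow_def_of_ne_zero (mul_ne_zero hLc h3), Complex.log_ofReal_mul hL h3,
      Complex.cpow_def_of_ne_zero hLc, Complex.cpow_def_of_ne_zero h3, ← Complex.exp_add,
      Complex.ofReal_log hL.le]
    ring_nf
  rw [hlogb, hpow, hpow, Complex.ofReal_cpow h0.le]
  ring

lemma arg_ofReal_mul_exp {r : ℝ} (h0 : 0 < r) {x : ℂ} (h1 : -Real.pi < x.im)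
    (h2 : x.im ≤ Real.pi) : (r * Complex.exp x : ℂ).arg = x.im := by
  rw [Complex.arg_real_mul _ h0, ← Complex.log_im, Complex.log_exp h1 h2]

/-! ### Local asymptotics of `f` at the saddle point -/

/-- Quadratic approximation of the phase at its saddle point. -/
lemma tendsto_phase {ι : Type*} {l : Filter ι} {lam : ℝ} (hlam : 0 < lam) {N : ι → ℕ}
    (hN : Tendsto N l atTop) {u : ι → ℂ} {u₀ : ℂ} (hu : Tendsto u l (𝓝 u₀)) :
    Tendsto (fun i => ((N i / lam : ℝ) : ℂ) *
        Complex.exp (lam * (u i / (Real.sqrt (N i) : ℂ))) -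
        ((N i / lam : ℝ) : ℂ) - u i * (Real.sqrt (N i) : ℂ)) l
      (𝓝 (lam * u₀ ^ 2 / 2)) := by
  have hs : Tendsto (fun i => Real.sqrt (N i)) l atTop :=
    Real.tendsto_sqrt_atTop.comp (tendsto_natCast_atTop_atTop.comp hN)
  have hmain : Tendsto (fun i => (lam : ℂ) * u i ^ 2 / 2) l (𝓝 (lam * u₀ ^ 2 / 2)) :=
    ((hu.pow 2).const_mul _).div_const _
  have hbound : Tendsto (fun i => lam ^ 2 * ‖u i‖ ^ 3 * Real.exp (lam * ‖u i‖) *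
      (Real.sqrt (N i))⁻¹) l (𝓝 0) := by
    have h1 : Tendsto (fun i => lam ^ 2 * ‖u i‖ ^ 3 * Real.exp (lam * ‖u i‖)) l
        (𝓝 (lam ^ 2 * ‖u₀‖ ^ 3 * Real.exp (lam * ‖u₀‖))) :=
      ((hu.norm.pow 3).const_mul _).mul
        ((Real.continuous_exp.tendsto _).comp (hu.norm.const_mul _))
    simpa using h1.mul (tendsto_inv_atTop_zero.comp hs)
  rw [← add_zero (lam * u₀ ^ 2 / 2 : ℂ)]
  have hdiff : Tendsto (fun i => ((N i / lam : ℝ) : ℂ) *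
        Complex.exp (lam * (u i / (Real.sqrt (N i) : ℂ))) -
        ((N i / lam : ℝ) : ℂ) - u i * (Real.sqrt (N i) : ℂ) - lam * u i ^ 2 / 2) l (𝓝 0) := by
    refine squeeze_zero_norm' ?_ hbound
    filter_upwards [hs.eventually_ge_atTop 1] with i hi
    set s := Real.sqrt (N i) with hsdef
    have hs0 : 0 < s := one_pos.trans_le hi
    have hsc : (s : ℂ) ≠ 0 := Complex.ofReal_ne_zero.2 hs0.ne'
    have hlc : (lam : ℂ) ≠ 0 := Complex.ofReal_ne_zero.2 hlam.ne'
    have hNs : (N i : ℝ) = s ^ 2 := (Real.sq_sqrt (Nat.cast_nonneg _)).symm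
    set y : ℂ := lam * (u i / s) with hy
    have hyn : ‖y‖ = lam * ‖u i‖ / s := by
      rw [hy, norm_mul, norm_div, Complex.norm_real, Complex.norm_real, Real.norm_of_nonneg hlam.le,
        Real.norm_of_nonneg hs0.le, mul_div_assoc]
    have hyle : ‖y‖ ≤ lam * ‖u i‖ := by
      rw [hyn]; exact div_le_self (by positivity) hi
    have key := Complex.norm_exp_sub_sum_le_norm_mul_exp y 3
    have e : ((N i / lam : ℝ) : ℂ) * Complex.exp y - ((N i / lam : ℝ) : ℂ) - u i * s -
        lam * u i ^ 2 / 2 = ((s ^ 2 / lam : ℝ) : ℂ) *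
          (Complex.exp y - ∑ m ∈ Finset.range 3, y ^ m / (m.factorial : ℂ)) := by
      rw [hNs]
      simp only [Finset.sum_range_succ, Finset.sum_range_zero, Nat.factorial]
      push_cast
      rw [show u i = y * s / lam by rw [hy]; field_simp]
      field_simp
      ring
    rw [e, norm_mul, Complex.norm_real, Real.norm_of_nonneg (by positivity)]
    calc s ^ 2 / lam * ‖Complex.exp y - ∑ m ∈ Finset.range 3, y ^ m / (m.factorial : ℂ)‖
        ≤ s ^ 2 / lam * (‖y‖ ^ 3 * Real.exp (lam * ‖u i‖)) := by
          refine mul_le_mul_of_nonneg_left (key.trans ?_) (by positivity)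
          gcongr
      _ = lam ^ 2 * ‖u i‖ ^ 3 * Real.exp (lam * ‖u i‖) * s⁻¹ := by
          rw [hyn]; field_simp
  exact (hmain.add hdiff).congr fun i => by ring

/-- Near the saddle point, in the coordinate `z = r_n * exp (u / √n)`, the quotient of `f z` by its
size at `r_n` and by `(z / r_n) ^ n` tends to the Gaussian `exp (lam * u ^ 2 / 2)`. -/
lemma tendsto_local {f : ℂ → ℂ} {a b : ℂ} {lam θ μ : ℝ} (hlam : 0 < lam) (hθ : 0 < θ)
    (hgrowth : HasSectorGrowth f a b lam θ μ) {ι : Type*} {l : Filter ι} {N : ι → ℕ}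
    (hN : Tendsto N l atTop) {u : ι → ℂ} {u₀ : ℂ} (hu : Tendsto u l (𝓝 u₀)) :
    Tendsto (fun i => f (scale lam (N i) * Complex.exp (u i / (Real.sqrt (N i) : ℂ))) *
        Complex.exp (-(u i * (Real.sqrt (N i) : ℂ))) / modelAtScale a b lam (N i)) l
      (𝓝 (Complex.exp (lam * u₀ ^ 2 / 2))) := by
  have hs : Tendsto (fun i => Real.sqrt (N i)) l atTop :=
    Real.tendsto_sqrt_atTop.comp (tendsto_natCast_atTop_atTop.comp hN)
  have hsinv : Tendsto (fun i => ((Real.sqrt (N i) : ℂ))⁻¹) l (𝓝 0) := by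
    have := (Complex.continuous_ofReal.tendsto 0).comp (tendsto_inv_atTop_zero.comp hs)
    simpa [Function.comp_def] using this
  have hx : Tendsto (fun i => u i / (Real.sqrt (N i) : ℂ)) l (𝓝 0) := by
    simpa [div_eq_mul_inv] using hu.mul hsinv
  have hr : Tendsto (fun i => scale lam (N i)) l atTop := (tendsto_scale hlam).comp hN
  have hLinv : Tendsto (fun i => ((Real.log (scale lam (N i)) : ℂ))⁻¹) l (𝓝 0) := by
    have := (Complex.continuous_ofReal.tendsto 0).comp
      (tendsto_inv_atTop_zero.comp (Real.tendsto_log_atTop.comp hr))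
    simpa [Function.comp_def] using this
  have hq : Tendsto (fun i => 1 + u i / (Real.sqrt (N i) : ℂ) / (Real.log (scale lam (N i)) : ℂ))
      l (𝓝 1) := by
    simpa [div_eq_mul_inv] using (hx.mul hLinv).const_add 1
  have him : Tendsto (fun i => (u i / (Real.sqrt (N i) : ℂ)).im) l (𝓝 0) := by
    have := (Complex.continuous_im.tendsto 0).comp hx
    rwa [Complex.zero_im] at this
  have him' : ∀ᶠ i in l, |(u i / (Real.sqrt (N i) : ℂ)).im| < min θ Real.pi := by
    have := him.abs
    rw [abs_zero] at this
    exact this.eventually_lt_const (lt_min hθ Real.pi_pos)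
  -- The points `z` run to infinity inside the sector.
  have hz : Tendsto (fun i => (scale lam (N i) : ℂ) * Complex.exp (u i / (Real.sqrt (N i) : ℂ))) l
      (cobounded ℂ ⊓ 𝓟 {z : ℂ | |z.arg| ≤ θ}) := by
    refine tendsto_inf.2 ⟨?_, tendsto_principal.2 ?_⟩
    · rw [← tendsto_norm_atTop_iff_cobounded]
      have h1 : Tendsto (fun i => ‖Complex.exp (u i / (Real.sqrt (N i) : ℂ))‖) l (𝓝 1) := by
        simpa using ((Complex.continuous_exp.tendsto 0).comp hx).norm
      have h2 := hr.atTop_mul_pos one_pos h1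
      refine h2.congr' ?_
      filter_upwards [hr.eventually_gt_atTop 0] with i hi
      rw [norm_mul, Complex.norm_real, Real.norm_of_nonneg hi.le]
    · filter_upwards [hr.eventually_gt_atTop 0, him'] with i hi hi'
      have h2 := abs_lt.1 (hi'.trans_le (min_le_right _ _))
      change |Complex.arg _| ≤ θ
      rw [arg_ofReal_mul_exp hi h2.1 h2.2.le]
      exact (hi'.trans_le (min_le_left _ _)).le
  have hE := hgrowth.1.comp_tendsto hz
  have hmodel : Tendsto (fun i => Complex.exp (a * (u i / (Real.sqrt (N i) : ℂ))) *
      (1 + u i / (Real.sqrt (N i) : ℂ) / (Real.log (scale lam (N i)) : ℂ)) ^ b *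
      Complex.exp (((N i / lam : ℝ) : ℂ) *
        Complex.exp (lam * (u i / (Real.sqrt (N i) : ℂ))) -
        ((N i / lam : ℝ) : ℂ) - u i * (Real.sqrt (N i) : ℂ))) l
      (𝓝 (Complex.exp (lam * u₀ ^ 2 / 2))) := by
    have h1 : Tendsto (fun i => Complex.exp (a * (u i / (Real.sqrt (N i) : ℂ)))) l (𝓝 1) := by
      simpa [Function.comp_def] using (Complex.continuous_exp.tendsto _).comp (hx.const_mul a)
    have h2 : Tendsto (fun i =>
        (1 + u i / (Real.sqrt (N i) : ℂ) / (Real.log (scale lam (N i)) : ℂ)) ^ b) l (𝓝 1) := by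
      simpa [Function.comp_def] using
        ((continuousAt_cpow_const (b := b) Complex.one_mem_slitPlane).tendsto).comp hq
    have h3 := (Complex.continuous_exp.tendsto _).comp (tendsto_phase hlam hN hu)
    simpa using (h1.mul h2).mul h3
  refine (IsEquivalent.tendsto_nhds (IsEquivalent.symm ?_) hmodel)
  have hE2 := hE.mul (IsEquivalent.refl (u := fun i =>
    Complex.exp (-(u i * (Real.sqrt (N i) : ℂ))) / modelAtScale a b lam (N i)) (l := l))
  refine (hE2.congr_left (.of_forall fun i => ?_)).congr_right ?_
  · simp [mul_div_assoc]
  · filter_upwards [hr.eventually_gt_atTop 1, him', hq.eventually_ne one_ne_zero] with i hi hi' hne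
    have h2 := abs_lt.1 (hi'.trans_le (min_le_right _ _))
    have hG := modelAtScale_ne_zero a b hi
    simp only [Pi.mul_apply, Function.comp_apply]
    rw [model_mul_exp a b lam hi h2.1 h2.2.le hne, scale_rpow hlam, Complex.exp_sub,
      Complex.exp_sub, Complex.exp_neg, mul_div_assoc', div_eq_iff hG, modelAtScale]
    have e1 := Complex.exp_ne_zero ((N i / lam : ℝ) : ℂ)
    have e2 := Complex.exp_ne_zero (u i * (Real.sqrt (N i) : ℂ))
    field_simp

/-! ### Gaussian bound for `f` on the whole circle `|z| = r_n` -/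

lemma norm_modelAtScale (a b : ℂ) {lam : ℝ} {n : ℕ} (h : 1 < scale lam n) :
    ‖modelAtScale a b lam n‖ = scale lam n ^ a.re * Real.log (scale lam n) ^ b.re *
      Real.exp (n / lam) := by
  rw [modelAtScale, norm_mul, norm_mul, Complex.norm_cpow_eq_rpow_re_of_pos (one_pos.trans h),
    Complex.norm_cpow_eq_rpow_re_of_pos (Real.log_pos h), Complex.norm_exp, Complex.ofReal_re]

/-- The model at `r_n` falls short of `exp (n / lam)` by at most a subexponential factor. -/
lemma exp_le_norm_modelAtScale (a b : ℂ) {lam δ : ℝ} (hlam : 0 < lam) (hδ : 0 < δ) :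
    ∀ᶠ n : ℕ in atTop, Real.exp (n / lam - δ * n) ≤ ‖modelAtScale a b lam n‖ := by
  have hr := tendsto_scale hlam
  have hlit : ∀ᶠ n : ℕ in atTop,
      scale lam n ^ (|a.re| + |b.re|) ≤ Real.exp (δ * n) := by
    have h1 := (isLittleO_rpow_exp_pos_mul_atTop (1 / lam * (|a.re| + |b.re|))
      (mul_pos hδ hlam)).bound one_pos
    have h2 : Tendsto (fun n : ℕ => (n : ℝ) / lam) atTop atTop :=
      tendsto_natCast_atTop_atTop.atTop_div_const hlam
    filter_upwards [h2.eventually h1] with n hn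
    have hX : (0 : ℝ) ≤ n / lam := by positivity
    rw [one_mul, Real.norm_of_nonneg (by positivity), Real.norm_of_nonneg (by positivity)] at hn
    rw [scale, ← Real.rpow_mul hX]
    refine hn.trans (le_of_eq ?_)
    congr 1
    field_simp
  filter_upwards [hlit, hr.eventually_ge_atTop (Real.exp 1)] with n hn hn'
  have he : (1 : ℝ) < Real.exp 1 := Real.one_lt_exp_iff.2 one_pos
  have h1 : 1 < scale lam n := he.trans_le hn'
  have h0 : 0 < scale lam n := one_pos.trans h1
  have hL1 : 1 ≤ Real.log (scale lam n) := by
    rw [Real.le_log_iff_exp_le h0]; exact hn'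
  have hLr : Real.log (scale lam n) ≤ scale lam n :=
    (Real.log_le_sub_one_of_pos h0).trans (by linarith)
  rw [norm_modelAtScale a b h1, sub_eq_neg_add, Real.exp_add]
  refine mul_le_mul_of_nonneg_right ?_ (Real.exp_pos _).le
  have ha : scale lam n ^ (-|a.re|) ≤ scale lam n ^ a.re :=
    Real.rpow_le_rpow_of_exponent_le h1.le (neg_abs_le _)
  have hb : scale lam n ^ (-|b.re|) ≤ Real.log (scale lam n) ^ b.re :=
    (Real.rpow_le_rpow_of_nonpos (one_pos.trans_le hL1) hLr (by simp)).trans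
      (Real.rpow_le_rpow_of_exponent_le hL1 (neg_abs_le _))
  calc Real.exp (-(δ * n)) ≤ (scale lam n ^ (|a.re| + |b.re|))⁻¹ := by
        rw [Real.exp_neg]
        exact inv_anti₀ (Real.rpow_pos_of_pos h0 _) hn
    _ = scale lam n ^ (-|a.re|) * scale lam n ^ (-|b.re|) := by
        rw [← Real.rpow_neg h0.le, ← Real.rpow_add h0]; ring_nf
    _ ≤ _ := by gcongr

lemma exists_norm_le_of_isBigO {f g : ℂ → ℂ} {s : Set ℂ} (h : f =O[cobounded ℂ ⊓ 𝓟 s] g) :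
    ∃ C R : ℝ, 0 ≤ C ∧ ∀ z ∈ s, R ≤ ‖z‖ → ‖f z‖ ≤ C * ‖g z‖ := by
  obtain ⟨C, hC, hb⟩ := h.exists_nonneg
  rw [isBigOWith_iff, eventually_inf_principal,
    (hasBasis_cobounded_norm (E := ℂ)).eventually_iff] at hb
  obtain ⟨R, -, hR⟩ := hb
  exact ⟨C, R, hC, fun z hz hzR => hR hzR hz⟩

/-- In the sector the bound comes from the model, whose modulus on `|z| = r_n` involves
`exp (n / lam * cos (lam * t))`. -/
lemma norm_le_of_mem_sector {f : ℂ → ℂ} {a b : ℂ} {lam θ μ : ℝ} (hlam : 0 < lam)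
    (hθ' : θ < min Real.pi (Real.pi / lam)) (hgrowth : HasSectorGrowth f a b lam θ μ) :
    ∃ C : ℝ, 0 ≤ C ∧ ∀ᶠ n : ℕ in atTop, ∀ t : ℝ, |t| ≤ θ →
      ‖f (scale lam n * Complex.exp (t * Complex.I))‖ ≤
        C * ‖modelAtScale a b lam n‖ * Real.exp (-(2 * lam / Real.pi ^ 2 * n * t ^ 2)) := by
  obtain ⟨C, R, hC, hb⟩ := exists_norm_le_of_isBigO hgrowth.1.isBigO
  have hr := tendsto_scale hlam
  have hcont : Tendsto (fun y : ℂ => ‖(1 + y) ^ b‖) (𝓝 0) (𝓝 1) := by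
    have h1 : Tendsto (fun y : ℂ => 1 + y) (𝓝 0) (𝓝 1) := by
      simpa using (tendsto_id (α := ℂ) (x := 𝓝 0)).const_add 1
    simpa [Function.comp_def] using
      (((continuousAt_cpow_const (b := b) Complex.one_mem_slitPlane).tendsto).comp h1).norm
  obtain ⟨δ, hδ, hδb⟩ := Metric.eventually_nhds_iff.1 (hcont.eventually_lt_const one_lt_two)
  refine ⟨C * (Real.exp (‖a‖ * Real.pi) * 2), by positivity, ?_⟩
  filter_upwards [hr.eventually_gt_atTop 1, hr.eventually_ge_atTop R,
    (Real.tendsto_log_atTop.comp hr).eventually_gt_atTop (Real.pi / min δ 1)] with n h1 hR hL t ht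
  have h0 : 0 < scale lam n := one_pos.trans h1
  have hL0 : 0 < Real.log (scale lam n) := Real.log_pos h1
  have htpi : |t| < Real.pi := ht.trans_lt (hθ'.trans_le (min_le_left _ _))
  have hltpi : |lam * t| ≤ Real.pi := by
    rw [abs_mul, abs_of_pos hlam, mul_comm, ← le_div_iff₀ hlam]
    exact ht.trans (hθ'.trans_le (min_le_right _ _)).le
  have him : (t * Complex.I : ℂ).im = t := by simp
  have hi1 : -Real.pi < (t * Complex.I : ℂ).im := by rw [him]; exact (abs_lt.1 htpi).1
  have hi2 : (t * Complex.I : ℂ).im ≤ Real.pi := by rw [him]; exact (abs_lt.1 htpi).2.le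
  have hy : ‖(t * Complex.I : ℂ) / (Real.log (scale lam n) : ℂ)‖ < min δ 1 := by
    rw [norm_div, Complex.norm_real, Real.norm_of_nonneg hL0.le, norm_mul, Complex.norm_I, mul_one,
      Complex.norm_real, Real.norm_eq_abs, div_lt_iff₀ hL0]
    rw [Function.comp_apply, div_lt_iff₀ (by positivity)] at hL
    linarith
  have hne : 1 + (t * Complex.I : ℂ) / (Real.log (scale lam n) : ℂ) ≠ 0 := fun h => by
    have h2 := hy.trans_le (min_le_right _ _)
    rw [eq_neg_of_add_eq_zero_right h, norm_neg, norm_one] at h2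
    exact lt_irrefl _ h2
  have hpow := hδb (y := (t * Complex.I : ℂ) / (Real.log (scale lam n) : ℂ))
    (by rw [dist_zero_right]; exact hy.trans_le (min_le_left _ _))
  have key := hb (scale lam n * Complex.exp (t * Complex.I))
    (by change |Complex.arg _| ≤ θ; rwa [arg_ofReal_mul_exp h0 hi1 hi2, him])
    (by rwa [norm_mul, Complex.norm_exp_ofReal_mul_I, mul_one, Complex.norm_real,
      Real.norm_of_nonneg h0.le])
  refine key.trans ?_
  rw [mul_assoc C, mul_assoc C]
  refine mul_le_mul_of_nonneg_left ?_ hC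
  rw [model_mul_exp a b lam h1 hi1 hi2 hne, scale_rpow hlam, modelAtScale]
  simp only [norm_mul]
  have e1 : ‖Complex.exp (a * (t * Complex.I))‖ ≤ Real.exp (‖a‖ * Real.pi) := by
    rw [Complex.norm_exp, Real.exp_le_exp]
    refine (Complex.re_le_norm _).trans ?_
    rw [norm_mul, norm_mul, Complex.norm_I, mul_one, Complex.norm_real, Real.norm_eq_abs]
    gcongr
  have e2 : ‖Complex.exp (((n / lam : ℝ) : ℂ) * Complex.exp (lam * (t * Complex.I)))‖ ≤
      ‖Complex.exp ((n / lam : ℝ) : ℂ)‖ *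
        Real.exp (-(2 * lam / Real.pi ^ 2 * n * t ^ 2)) := by
    have hre : (((n / lam : ℝ) : ℂ) * Complex.exp (lam * (t * Complex.I))).re =
        n / lam * Real.cos (lam * t) := by
      rw [Complex.re_ofReal_mul, ← mul_assoc, ← Complex.ofReal_mul, Complex.exp_ofReal_mul_I_re]
    rw [Complex.norm_exp, hre, Complex.norm_exp, Complex.ofReal_re, ← Real.exp_add,
      Real.exp_le_exp]
    calc (n / lam * Real.cos (lam * t) : ℝ)
        ≤ n / lam * (1 - 2 / Real.pi ^ 2 * (lam * t) ^ 2) := by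
          gcongr
          exact Real.cos_le_one_sub_mul_cos_sq hltpi
      _ = n / lam + -(2 * lam / Real.pi ^ 2 * n * t ^ 2) := by field_simp; ring
  calc ‖(scale lam n : ℂ) ^ a‖ * ‖(Real.log (scale lam n) : ℂ) ^ b‖ *
        (‖Complex.exp (a * (t * Complex.I))‖ *
          ‖(1 + (t * Complex.I : ℂ) / (Real.log (scale lam n) : ℂ)) ^ b‖ *
        ‖Complex.exp (((n / lam : ℝ) : ℂ) * Complex.exp (lam * (t * Complex.I)))‖)
      ≤ ‖(scale lam n : ℂ) ^ a‖ * ‖(Real.log (scale lam n) : ℂ) ^ b‖ *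
        (Real.exp (‖a‖ * Real.pi) * 2 * (‖Complex.exp ((n / lam : ℝ) : ℂ)‖ *
        Real.exp (-(2 * lam / Real.pi ^ 2 * n * t ^ 2)))) := by
        gcongr
    _ = _ := by ring

lemma norm_le_of_notMem_sector {f : ℂ → ℂ} {a b : ℂ} {lam θ μ : ℝ} (hlam : 0 < lam)
    (hμ : μ < 1) (hgrowth : HasSectorGrowth f a b lam θ μ) :
    ∃ C : ℝ, 0 ≤ C ∧ ∀ᶠ n : ℕ in atTop, ∀ t ∈ Set.Ioc (-Real.pi) Real.pi, θ < |t| →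
      ‖f (scale lam n * Complex.exp (t * Complex.I))‖ ≤
        C * ‖modelAtScale a b lam n‖ *
          Real.exp (-((1 - μ) / (2 * lam * Real.pi ^ 2) * n * t ^ 2)) := by
  have hO : f =O[cobounded ℂ ⊓ 𝓟 {z : ℂ | θ < |z.arg|}]
      fun z : ℂ => ((Real.exp (μ * ‖z‖ ^ lam) : ℝ) : ℂ) :=
    hgrowth.2.trans (isBigO_of_le _ fun z => by rw [Complex.norm_real])
  obtain ⟨C, R, hC, hb⟩ := exists_norm_le_of_isBigO hO
  have hr := tendsto_scale hlam
  refine ⟨C, hC, ?_⟩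
  filter_upwards [hr.eventually_gt_atTop 0, hr.eventually_ge_atTop R,
    exp_le_norm_modelAtScale a b hlam (δ := (1 - μ) / (2 * lam))
      (div_pos (by linarith) (by positivity))] with n h0 hR hG t ht htθ
  have him : (t * Complex.I : ℂ).im = t := by simp
  have hnorm : ‖(scale lam n : ℂ) * Complex.exp (t * Complex.I)‖ = scale lam n := by
    rw [norm_mul, Complex.norm_exp_ofReal_mul_I, mul_one, Complex.norm_real,
      Real.norm_of_nonneg h0.le]
  have key := hb (scale lam n * Complex.exp (t * Complex.I))
    (by
      change θ < |Complex.arg _|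
      rwa [arg_ofReal_mul_exp h0 (by rw [him]; exact ht.1) (by rw [him]; exact ht.2), him])
    (by rwa [hnorm])
  refine key.trans ?_
  rw [mul_assoc, hnorm, scale_rpow hlam, Complex.norm_real, Real.norm_of_nonneg (Real.exp_pos _).le]
  refine mul_le_mul_of_nonneg_left ?_ hC
  refine le_trans ?_ (mul_le_mul_of_nonneg_right hG (Real.exp_pos _).le)
  rw [← Real.exp_add, Real.exp_le_exp]
  have ht2 : t ^ 2 ≤ Real.pi ^ 2 := sq_le_sq' ht.1.le ht.2
  have h1 : (1 - μ) / (2 * lam * Real.pi ^ 2) * n * t ^ 2 ≤ (1 - μ) / (2 * lam) * n := by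
    calc (1 - μ) / (2 * lam * Real.pi ^ 2) * n * t ^ 2
        ≤ (1 - μ) / (2 * lam * Real.pi ^ 2) * n * Real.pi ^ 2 := by
          refine mul_le_mul_of_nonneg_left ht2 (mul_nonneg (div_nonneg ?_ ?_) ?_) <;>
            positivity
      _ = (1 - μ) / (2 * lam) * n := by
          have := Real.pi_ne_zero
          field_simp
  have h2 : (n : ℝ) / lam - (1 - μ) / (2 * lam) * n - (1 - μ) / (2 * lam) * n = μ * (n / lam) := by
    field_simp; ring
  linarith

/-- Relative to its size at `r_n`, the function `f` is dominated by a Gaussian on the whole circle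
`|z| = r_n`; this makes the Cauchy integral over that circle concentrate at `r_n`. -/
lemma norm_le_gaussian {f : ℂ → ℂ} {a b : ℂ} {lam θ μ : ℝ} (hlam : 0 < lam)
    (hθ' : θ < min Real.pi (Real.pi / lam)) (hμ : μ < 1)
    (hgrowth : HasSectorGrowth f a b lam θ μ) :
    ∃ C c : ℝ, 0 ≤ C ∧ 0 < c ∧ ∀ᶠ n : ℕ in atTop, ∀ t ∈ Set.Ioc (-Real.pi) Real.pi,
      ‖f (scale lam n * Complex.exp (t * Complex.I))‖ ≤
        C * ‖modelAtScale a b lam n‖ * Real.exp (-(c * n * t ^ 2)) := by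
  obtain ⟨C₁, hC₁, h₁⟩ := norm_le_of_mem_sector hlam hθ' hgrowth
  obtain ⟨C₂, hC₂, h₂⟩ := norm_le_of_notMem_sector hlam hμ hgrowth
  have hp := Real.pi_pos
  refine ⟨max C₁ C₂, min (2 * lam / Real.pi ^ 2) ((1 - μ) / (2 * lam * Real.pi ^ 2)),
    hC₁.trans (le_max_left _ _),
    lt_min (by positivity) (div_pos (by linarith) (by positivity)), ?_⟩
  filter_upwards [h₁, h₂] with n hn₁ hn₂ t ht
  rcases le_or_gt |t| θ with h | h
  · refine (hn₁ t h).trans ?_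
    gcongr
    exacts [le_max_left _ _, min_le_left _ _]
  · refine (hn₂ t ht h).trans ?_
    gcongr
    exacts [le_max_right _ _, min_le_right _ _]

/-! ### The Cauchy integral for the remainder of the Maclaurin series -/

lemma partialSum_eq_circleIntegral {f : ℂ → ℂ} (hf : Differentiable ℂ f) {R : ℝ} (hR : 0 < R)
    (n : ℕ) (z : ℂ) :
    (2 * Real.pi * Complex.I : ℂ) * partialSum f n z =
      ∮ s in C(0, R), (∑ k ∈ Finset.range (n + 1), z ^ k / s ^ (k + 1)) * f s := by
  have hterm (k : ℕ) : CircleIntegrable (fun s => z ^ k / s ^ (k + 1) * f s) 0 R := by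
    refine ContinuousOn.circleIntegrable hR.le (ContinuousOn.mul (ContinuousOn.div
      continuousOn_const (by fun_prop) fun s hs => pow_ne_zero _ ?_) hf.continuous.continuousOn)
    exact ne_zero_of_mem_sphere hR.ne' ⟨s, hs⟩
  simp_rw [Finset.sum_mul]
  rw [circleIntegral.integral_fun_sum fun k _ => hterm k, partialSum, Finset.mul_sum]
  refine Finset.sum_congr rfl fun k _ => ?_
  have := (hf.differentiableOn (s := Metric.closedBall 0 R)).circleIntegral_one_div_sub_center_pow_smul
    hR k
  simp only [sub_zero, smul_eq_mul] at this
  calc (2 * Real.pi * Complex.I : ℂ) * (iteratedDeriv k f 0 / k.factorial * z ^ k)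
      = z ^ k * (2 * Real.pi * Complex.I / k.factorial * iteratedDeriv k f 0) := by ring
    _ = _ := by
      rw [← this, ← circleIntegral.integral_const_mul]
      congr 1; ext s; ring

lemma sub_partialSum_eq_circleIntegral {f : ℂ → ℂ} (hf : Differentiable ℂ f) {R : ℝ} {n : ℕ}
    {z : ℂ} (hz : ‖z‖ < R) :
    (2 * Real.pi * Complex.I : ℂ) * (f z - partialSum f n z) =
      ∮ s in C(0, R), (z / s) ^ (n + 1) * (s - z)⁻¹ * f s := by
  have hR : 0 < R := (norm_nonneg z).trans_lt hz
  have hs0 {s : ℂ} (hs : s ∈ Metric.sphere (0 : ℂ) R) : s ≠ 0 :=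
    ne_zero_of_mem_sphere hR.ne' ⟨s, hs⟩
  have hsz {s : ℂ} (hs : s ∈ Metric.sphere (0 : ℂ) R) : s - z ≠ 0 := fun h => by
    rw [mem_sphere_zero_iff_norm, sub_eq_zero.1 h] at hs
    exact hz.ne hs
  have hc := (hf.differentiableOn (s := Metric.closedBall 0 R)).circleIntegral_sub_inv_smul
    (mem_ball_zero_iff.2 hz)
  simp only [smul_eq_mul] at hc
  rw [mul_sub, ← hc, partialSum_eq_circleIntegral hf hR, ← circleIntegral.integral_sub]
  · refine circleIntegral.integral_congr hR.le fun s hs => ?_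
    have h0 := hs0 hs
    have h1 := hsz hs
    have hgeom : (∑ k ∈ Finset.range (n + 1), z ^ k / s ^ (k + 1)) =
        (1 - (z / s) ^ (n + 1)) * (s - z)⁻¹ := by
      have e : ∀ k, z ^ k / s ^ (k + 1) = (z / s) ^ k * s⁻¹ := fun k => by
        rw [div_pow, pow_succ]; field_simp
      simp_rw [e]
      rw [← Finset.sum_mul]
      have hne : z / s ≠ 1 := fun h => h1 (by rw [(div_eq_one_iff_eq h0).1 h, sub_self])
      have := geom_sum_mul (z / s) (n + 1)
      have hne' : z / s - 1 ≠ 0 := sub_ne_zero.2 hne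
      rw [eq_mul_inv_iff_mul_eq₀ h1]
      have e2 : s⁻¹ * (s - z) = -(z / s - 1) := by field_simp; ring
      rw [mul_assoc, e2, mul_neg, this]
      ring
    simp only [hgeom]
    ring
  · refine ContinuousOn.circleIntegrable hR.le (ContinuousOn.mul (ContinuousOn.inv₀
      (by fun_prop) fun s hs => hsz hs) hf.continuous.continuousOn)
  · refine ContinuousOn.circleIntegrable hR.le (ContinuousOn.mul (continuousOn_finsetSum _
      fun k _ => ContinuousOn.div continuousOn_const (by fun_prop) fun s hs =>
        pow_ne_zero _ (hs0 hs)) hf.continuous.continuousOn)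

/-- The remainder at `R * exp x` as an integral over the angle, rescaled by the factor `s`. -/
lemma sub_partialSum_eq_integral {f : ℂ → ℂ} (hf : Differentiable ℂ f) {R : ℝ} (hR : 0 < R)
    {n : ℕ} (hn : 0 < n) {x : ℂ} (hx : x.re < 0) {s : ℝ} (hs : 0 < s) :
    f (R * Complex.exp x) - partialSum f (n - 1) (R * Complex.exp x) =
      (2 * Real.pi : ℂ)⁻¹ * ∫ τ in (-(Real.pi * s))..(Real.pi * s),
        Complex.exp (n * (x - (τ / s : ℝ) * Complex.I)) *
          f (R * Complex.exp ((τ / s : ℝ) * Complex.I)) /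
          (s * (1 - Complex.exp (x - (τ / s : ℝ) * Complex.I))) := by
  obtain ⟨m, rfl⟩ : ∃ m, n = m + 1 := ⟨n - 1, by omega⟩
  have hRc : (R : ℂ) ≠ 0 := Complex.ofReal_ne_zero.2 hR.ne'
  have hsc : (s : ℂ) ≠ 0 := Complex.ofReal_ne_zero.2 hs.ne'
  have hz : ‖(R * Complex.exp x : ℂ)‖ < R := by
    rw [norm_mul, Complex.norm_real, Real.norm_of_nonneg hR.le, Complex.norm_exp]
    exact mul_lt_of_lt_one_right hR (Real.exp_lt_one_iff.2 hx)
  set F : ℝ → ℂ := fun t => Complex.exp ((m + 1 : ℕ) * (x - (t : ℂ) * Complex.I)) *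
          f (R * Complex.exp ((t : ℂ) * Complex.I)) /
          (s * (1 - Complex.exp (x - (t : ℂ) * Complex.I))) with hF
  have hper : Function.Periodic F (2 * Real.pi) := fun t => by
    have e1 : Complex.exp (((t + 2 * Real.pi : ℝ) : ℂ) * Complex.I) =
        Complex.exp (t * Complex.I) := by
      push_cast
      rw [add_mul, Complex.exp_add, Complex.exp_two_pi_mul_I, mul_one]
    have e2 : Complex.exp (x - ((t + 2 * Real.pi : ℝ) : ℂ) * Complex.I) =
        Complex.exp (x - t * Complex.I) := by rw [Complex.exp_sub, Complex.exp_sub, e1]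
    simp only [hF]
    rw [Complex.exp_nat_mul, Complex.exp_nat_mul, e2, e1]
  have hint : (∫ τ in (-(Real.pi * s))..(Real.pi * s), F (τ / s)) =
      (s : ℂ) * ∫ t in (0 : ℝ)..2 * Real.pi, F t := by
    rw [intervalIntegral.integral_comp_div F hs.ne', Complex.real_smul]
    have := hper.intervalIntegral_add_eq (-Real.pi) 0
    rw [zero_add, show -Real.pi + 2 * Real.pi = Real.pi by ring] at this
    rw [neg_div, mul_div_assoc, div_self hs.ne', mul_one, this]
  have hc := sub_partialSum_eq_circleIntegral hf (n := m) hz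
  have hpi : (Real.pi : ℂ) ≠ 0 := Complex.ofReal_ne_zero.2 Real.pi_ne_zero
  change _ = (2 * Real.pi : ℂ)⁻¹ * ∫ τ in (-(Real.pi * s))..(Real.pi * s), F (τ / s)
  rw [hint, Nat.add_sub_cancel, eq_inv_mul_iff_mul_eq₀ (mul_ne_zero two_ne_zero hpi)]
  refine mul_left_cancel₀ Complex.I_ne_zero ?_
  rw [← mul_assoc, show Complex.I * (2 * Real.pi : ℂ) = 2 * Real.pi * Complex.I by ring, hc,
    circleIntegral, ← intervalIntegral.integral_const_mul, ← intervalIntegral.integral_const_mul]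
  refine intervalIntegral.integral_congr fun t _ => ?_
  have hexp : Complex.exp (t * Complex.I) ≠ 0 := Complex.exp_ne_zero _
  have hx1 : Complex.exp (x - t * Complex.I) = Complex.exp x / Complex.exp (t * Complex.I) :=
    Complex.exp_sub _ _
  have hne : Complex.exp (t * Complex.I) - Complex.exp x ≠ 0 := fun h => by
    have h1 := congrArg norm (sub_eq_zero.1 h)
    rw [Complex.norm_exp_ofReal_mul_I, Complex.norm_exp] at h1
    exact (Real.exp_lt_one_iff.2 hx).ne' h1
  simp only [hF, deriv_circleMap, circleMap_zero, smul_eq_mul]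
  rw [Complex.exp_nat_mul, hx1, mul_div_mul_left _ _ hRc, ← mul_sub]
  have h2 : 1 - Complex.exp x / Complex.exp (t * Complex.I) =
      (Complex.exp (t * Complex.I) - Complex.exp x) / Complex.exp (t * Complex.I) := by
    field_simp
  rw [h2]
  field_simp

/-! ### Gaussian integrals and the complementary error function -/

lemma integrable_erfc_integrand (z : ℂ) :
    MeasureTheory.Integrable fun t : ℝ => Complex.exp (-(z + (t : ℂ)) ^ 2) := by
  refine (integrable_cexp_quadratic' (b := -1) (by simp) (-2 * z)
    (-z ^ 2)).congr (.of_forall fun t => ?_)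
  simp only
  congr 1; ring

lemma erfc_add_erfc_neg (z : ℂ) : erfc z + erfc (-z) = 2 := by
  have hint := integrable_erfc_integrand z
  have hneg : (∫ t in Set.Ioi (0 : ℝ), Complex.exp (-(-z + (t : ℂ)) ^ 2)) =
      ∫ t in Set.Iic (0 : ℝ), Complex.exp (-(z + (t : ℂ)) ^ 2) := by
    have := integral_comp_neg_Ioi (0 : ℝ) fun t : ℝ => Complex.exp (-(z + (t : ℂ)) ^ 2)
    rw [neg_zero] at this
    rw [← this]
    congr 1; ext t; congr 1; push_cast; ring
  have htot : (∫ t : ℝ, Complex.exp (-(z + (t : ℂ)) ^ 2)) = (Real.sqrt Real.pi : ℂ) := by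
    have h := integral_cexp_quadratic (b := -1) (by simp) (-2 * z) (-z ^ 2)
    have e : ∀ t : ℝ, Complex.exp (-(z + (t : ℂ)) ^ 2) =
        Complex.exp (-1 * (t : ℂ) ^ 2 + -2 * z * t + -z ^ 2) := fun t => by congr 1; ring
    simp_rw [e]
    rw [h, show -z ^ 2 - (-2 * z) ^ 2 / (4 * (-1)) = (0 : ℂ) by ring, Complex.exp_zero, mul_one,
      neg_neg, div_one, Real.sqrt_eq_rpow, Complex.ofReal_cpow Real.pi_pos.le]
    norm_num
  have hpi : (Real.sqrt Real.pi : ℂ) ≠ 0 :=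
    Complex.ofReal_ne_zero.2 (Real.sqrt_pos.2 Real.pi_pos).ne'
  have hsplit : (∫ t in Set.Ioi (0 : ℝ), Complex.exp (-(z + (t : ℂ)) ^ 2)) +
      (∫ t in Set.Iic (0 : ℝ), Complex.exp (-(z + (t : ℂ)) ^ 2)) = (Real.sqrt Real.pi : ℂ) := by
    rw [add_comm, ← Set.compl_Iic, MeasureTheory.integral_add_compl measurableSet_Iic hint, htot]
  rw [erfc, erfc, hneg, ← mul_add, hsplit]
  field_simp

/-- The Cauchy transform of a Gaussian along the imaginary axis is a complementary error function:
write `1 / (i τ - u)` as a Laplace integral and integrate the Gaussian first. -/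
lemma integral_gaussian_div {lam : ℝ} (hlam : 0 < lam) {u : ℂ} (hu : u.re < 0) :
    (2 * Real.pi : ℂ)⁻¹ * (∫ τ : ℝ, Complex.exp (lam * (τ * Complex.I) ^ 2 / 2) /
      -(u - τ * Complex.I)) =
      Complex.exp (lam * u ^ 2 / 2) * (1 / 2 * erfc (-(u * (Real.sqrt (lam / 2) : ℂ)))) := by
  set q := Real.sqrt (lam / 2) with hq
  have hq0 : 0 < q := Real.sqrt_pos.2 (by positivity)
  have hlq : lam = 2 * q ^ 2 := by rw [hq, Real.sq_sqrt (by positivity)]; ring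
  have hqc : (q : ℂ) ≠ 0 := Complex.ofReal_ne_zero.2 hq0.ne'
  have hlqc : (lam : ℂ) = 2 * (q : ℂ) ^ 2 := by rw [hlq]; push_cast; ring
  have hpc : (Real.sqrt Real.pi : ℂ) ≠ 0 :=
    Complex.ofReal_ne_zero.2 (Real.sqrt_pos.2 Real.pi_pos).ne'
  have hre (τ : ℝ) : (u - τ * Complex.I).re = u.re := by simp
  let k : ℝ → ℝ → ℂ := fun τ x => Complex.exp (lam * (τ * Complex.I) ^ 2 / 2) *
    Complex.exp ((u - τ * Complex.I) * x)
  have hlap (τ : ℝ) : Complex.exp (lam * (τ * Complex.I) ^ 2 / 2) / -(u - τ * Complex.I) =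
      ∫ x in Set.Ioi (0 : ℝ), k τ x := by
    have := integral_exp_mul_complex_Ioi (a := u - τ * Complex.I) (by rwa [hre]) 0
    simp only [k]
    rw [MeasureTheory.integral_const_mul, this, Complex.ofReal_zero, mul_zero, Complex.exp_zero,
      div_neg, neg_div, mul_neg, mul_one_div]
  have hgauss : MeasureTheory.Integrable fun τ : ℝ => Real.exp (-(lam / 2) * τ ^ 2) :=
    integrable_exp_neg_mul_sq (by positivity)
  have hexp : MeasureTheory.IntegrableOn (fun x : ℝ => Real.exp (u.re * x)) (Set.Ioi 0) := by
    have := integrableOn_exp_mul_Ioi hu 0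
    exact this
  have hk : MeasureTheory.Integrable (Function.uncurry k)
      (MeasureTheory.volume.prod (MeasureTheory.volume.restrict (Set.Ioi 0))) := by
    refine (hgauss.mul_prod hexp).mono' ?_ (.of_forall fun p => le_of_eq ?_)
    · refine Continuous.aestronglyMeasurable ?_
      simp only [k, Function.uncurry_def]
      fun_prop
    · simp only [k, Function.uncurry_def, norm_mul, Complex.norm_exp]
      have e1 : ((lam : ℂ) * ((p.1 : ℂ) * Complex.I) ^ 2 / 2) =
          ((-(lam / 2) * p.1 ^ 2 : ℝ) : ℂ) := by
        rw [mul_pow, Complex.I_sq]; push_cast; ring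
      rw [e1, Complex.ofReal_re, mul_comm (u - _), Complex.re_ofReal_mul, hre, mul_comm p.2]
  have hinner (x : ℝ) : (∫ τ : ℝ, k τ x) =
      (Real.sqrt Real.pi : ℂ) / q * Complex.exp (u * x - x ^ 2 / (2 * lam)) := by
    have h := integral_cexp_quadratic (b := ((-(lam / 2) : ℝ) : ℂ))
      (by rw [Complex.ofReal_re]; linarith) (-(x * Complex.I)) (u * x)
    have e : ∀ τ : ℝ, k τ x = Complex.exp (((-(lam / 2) : ℝ) : ℂ) * (τ : ℂ) ^ 2 +
        -(x * Complex.I) * τ + u * x) := fun τ => by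
      simp only [k]
      rw [← Complex.exp_add]
      congr 1
      rw [mul_pow, Complex.I_sq]; push_cast; ring
    simp_rw [e]
    rw [h]
    congr 1
    · rw [← Complex.ofReal_neg, neg_neg, ← Complex.ofReal_div,
        show ((1 : ℂ) / 2) = ((1 / 2 : ℝ) : ℂ) by push_cast; ring,
        ← Complex.ofReal_cpow (by positivity), ← Complex.ofReal_div, ← Real.sqrt_eq_rpow, hq,
        Real.sqrt_div Real.pi_pos.le]
    · congr 1
      rw [neg_sq, mul_pow, Complex.I_sq, hlqc]
      push_cast
      rw [hlqc]
      field_simp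
      ring
  simp_rw [hlap]
  rw [MeasureTheory.integral_integral_swap hk]
  simp_rw [hinner]
  rw [MeasureTheory.integral_const_mul]
  have hscale := MeasureTheory.integral_comp_mul_left_Ioi
    (fun x : ℝ => Complex.exp (u * x - x ^ 2 / (2 * lam))) 0 (b := 2 * q) (by positivity)
  rw [mul_zero, Complex.real_smul] at hscale
  have hsub : (∫ t in Set.Ioi (0 : ℝ), Complex.exp (-(-(u * (q : ℂ)) + (t : ℂ)) ^ 2)) =
      Complex.exp (-(lam * u ^ 2 / 2)) * (((2 * q)⁻¹ : ℝ) *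
        ∫ x in Set.Ioi (0 : ℝ), Complex.exp (u * x - x ^ 2 / (2 * lam))) := by
    rw [← hscale, ← MeasureTheory.integral_const_mul]
    congr 1; ext t
    rw [← Complex.exp_add]
    congr 1
    rw [hlqc]
    push_cast
    field_simp
    ring
  rw [erfc, hsub, Complex.exp_neg]
  have hE := Complex.exp_ne_zero (lam * u ^ 2 / 2)
  have hpp : (Real.pi : ℂ) = (Real.sqrt Real.pi : ℂ) ^ 2 := by
    rw [← Complex.ofReal_pow, Real.sq_sqrt Real.pi_pos.le]
  rw [hpp]
  push_cast
  field_simp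

/-! ### Concentration of the Cauchy integral at the saddle point -/

lemma tendsto_mul_one_sub_exp {ι : Type*} {l : Filter ι} {s : ι → ℝ} (hs : Tendsto s l atTop)
    {v : ι → ℂ} {v₀ : ℂ} (hv : Tendsto v l (𝓝 v₀)) :
    Tendsto (fun i => (s i : ℂ) * (1 - Complex.exp (v i / s i))) l (𝓝 (-v₀)) := by
  have hbound : Tendsto (fun i => ‖v i‖ ^ 2 * Real.exp ‖v i‖ * (s i)⁻¹) l (𝓝 0) := by
    have h1 : Tendsto (fun i => ‖v i‖ ^ 2 * Real.exp ‖v i‖) l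
        (𝓝 (‖v₀‖ ^ 2 * Real.exp ‖v₀‖)) :=
      (hv.norm.pow 2).mul ((Real.continuous_exp.tendsto _).comp hv.norm)
    simpa using h1.mul (tendsto_inv_atTop_zero.comp hs)
  have hdiff : Tendsto (fun i => (s i : ℂ) * (1 - Complex.exp (v i / s i)) + v i) l (𝓝 0) := by
    refine squeeze_zero_norm' ?_ hbound
    filter_upwards [hs.eventually_ge_atTop 1] with i hi
    have hs0 : 0 < s i := one_pos.trans_le hi
    have hsc : (s i : ℂ) ≠ 0 := Complex.ofReal_ne_zero.2 hs0.ne'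
    set y : ℂ := v i / s i with hy
    have hyn : ‖y‖ = ‖v i‖ / s i := by
      rw [hy, norm_div, Complex.norm_real, Real.norm_of_nonneg hs0.le]
    have hyle : ‖y‖ ≤ ‖v i‖ := by rw [hyn]; exact div_le_self (norm_nonneg _) hi
    have key := Complex.norm_exp_sub_sum_le_norm_mul_exp y 2
    have e : (s i : ℂ) * (1 - Complex.exp y) + v i =
        -((s i : ℂ) * (Complex.exp y - ∑ m ∈ Finset.range 2, y ^ m / (m.factorial : ℂ))) := by
      rw [show v i = y * s i by rw [hy]; field_simp]
      simp only [Finset.sum_range_succ, Finset.sum_range_zero, Nat.factorial]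
      push_cast
      ring
    rw [e, norm_neg, norm_mul, Complex.norm_real, Real.norm_of_nonneg hs0.le]
    calc s i * ‖Complex.exp y - ∑ m ∈ Finset.range 2, y ^ m / (m.factorial : ℂ)‖
        ≤ s i * (‖y‖ ^ 2 * Real.exp ‖v i‖) := by
          refine mul_le_mul_of_nonneg_left (key.trans ?_) hs0.le
          gcongr
      _ = ‖v i‖ ^ 2 * Real.exp ‖v i‖ * (s i)⁻¹ := by rw [hyn]; field_simp
  simpa using hdiff.sub hv

/-- Limit of the remainder of the Maclaurin series, in the coordinate `z = r_n * exp (u / √n)` and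
with the normalization of `tendsto_local`. -/
lemma tendsto_remainder {f : ℂ → ℂ} (hf : Differentiable ℂ f) {a b : ℂ} {lam θ μ : ℝ}
    (hlam : 0 < lam) (hθ : 0 < θ) (hθ' : θ < min Real.pi (Real.pi / lam)) (hμ : μ < 1)
    (hgrowth : HasSectorGrowth f a b lam θ μ) {ι : Type*} {l : Filter ι}
    [l.IsCountablyGenerated] {N : ι → ℕ} (hN : Tendsto N l atTop) {u : ι → ℂ} {u₀ : ℂ}
    (hu : Tendsto u l (𝓝 u₀)) (hu₀ : u₀.re < 0) :
    Tendsto (fun i => (f (scale lam (N i) * Complex.exp (u i / (Real.sqrt (N i) : ℂ))) -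
        partialSum f (N i - 1) (scale lam (N i) * Complex.exp (u i / (Real.sqrt (N i) : ℂ)))) *
        Complex.exp (-(u i * (Real.sqrt (N i) : ℂ))) / modelAtScale a b lam (N i)) l
      (𝓝 (Complex.exp (lam * u₀ ^ 2 / 2) *
        (1 / 2 * erfc (-(u₀ * (Real.sqrt (lam / 2) : ℂ)))))) := by
  obtain ⟨C, c, hC, hc, hbd⟩ := norm_le_gaussian hlam hθ' hμ hgrowth
  have hs : Tendsto (fun i => Real.sqrt (N i)) l atTop :=
    Real.tendsto_sqrt_atTop.comp (tendsto_natCast_atTop_atTop.comp hN)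
  have hr : Tendsto (fun i => scale lam (N i)) l atTop := (tendsto_scale hlam).comp hN
  have hure : Tendsto (fun i => (u i).re) l (𝓝 u₀.re) := (Complex.continuous_re.tendsto _).comp hu
  let H : ι → ℝ → ℂ := fun i τ =>
    (Set.Ioc (-(Real.pi * Real.sqrt (N i))) (Real.pi * Real.sqrt (N i))).indicator (fun τ : ℝ =>
      f (scale lam (N i) * Complex.exp (τ * Complex.I / (Real.sqrt (N i) : ℂ))) *
        Complex.exp (-(τ * Complex.I * (Real.sqrt (N i) : ℂ))) / modelAtScale a b lam (N i) /
      ((Real.sqrt (N i) : ℂ) * (1 - Complex.exp ((u i - τ * Complex.I) / (Real.sqrt (N i) : ℂ))))) τ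
  have hmain : Tendsto (fun i => ∫ τ : ℝ, H i τ) l
      (𝓝 (∫ τ : ℝ, Complex.exp (lam * (τ * Complex.I) ^ 2 / 2) / -(u₀ - τ * Complex.I))) := by
    refine MeasureTheory.tendsto_integral_filter_of_dominated_convergence
      (fun τ => C * Real.exp (-c * τ ^ 2) / (-u₀.re / 2)) ?_ ?_ ?_ ?_
    · refine .of_forall fun i => ?_
      refine (Measurable.aestronglyMeasurable ?_)
      refine Measurable.indicator ?_ measurableSet_Ioc
      have := hf.continuous.measurable
      fun_prop
    · -- `|1 - exp ((u - i τ) / √n)| ≥ 1 - exp (Re u / √n)`, and this is of order `1 / √n`.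
      have hden : ∀ᶠ i in l, -u₀.re / 2 ≤
          Real.sqrt (N i) * (1 - Real.exp ((u i).re / Real.sqrt (N i))) := by
        have h1 : Tendsto (fun i => ((u i).re : ℂ)) l (𝓝 (u₀.re : ℂ)) :=
          (Complex.continuous_ofReal.tendsto _).comp hure
        have h2 := (Complex.continuous_re.tendsto _).comp (tendsto_mul_one_sub_exp hs h1)
        have h3 : Tendsto (fun i => Real.sqrt (N i) *
            (1 - Real.exp ((u i).re / Real.sqrt (N i)))) l (𝓝 (-u₀.re)) := by
          have e : (-(u₀.re : ℂ)).re = -u₀.re := by simp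
          rw [e] at h2
          refine h2.congr fun i => ?_
          rw [Function.comp_apply, ← Complex.ofReal_div, ← Complex.ofReal_exp,
            ← Complex.ofReal_one, ← Complex.ofReal_sub, ← Complex.ofReal_mul, Complex.ofReal_re]
        exact (h3.eventually_const_lt (by linarith)).mono fun _ h => h.le
      filter_upwards [hden, hN.eventually hbd, hs.eventually_gt_atTop 0,
        hr.eventually_gt_atTop 1] with i hi hfi hsi hri
      refine .of_forall fun τ => ?_
      have hsc : (Real.sqrt (N i) : ℂ) ≠ 0 := Complex.ofReal_ne_zero.2 hsi.ne'
      have hpos : 0 < -u₀.re / 2 := by linarith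
      by_cases hτ : τ ∈ Set.Ioc (-(Real.pi * Real.sqrt (N i))) (Real.pi * Real.sqrt (N i))
      swap
      · simp only [H]
        rw [Set.indicator_of_notMem hτ, norm_zero]
        positivity
      simp only [H]
      rw [Set.indicator_of_mem hτ]
      have hG := norm_pos_iff.2 (modelAtScale_ne_zero a b hri)
      have hmem : τ / Real.sqrt (N i) ∈ Set.Ioc (-Real.pi) Real.pi := by
        refine ⟨?_, ?_⟩
        · rw [lt_div_iff₀ hsi]; linarith [hτ.1]
        · rw [div_le_iff₀ hsi]; exact hτ.2
      have h1 := hfi _ hmem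
      have e1 : ((τ / Real.sqrt (N i) : ℝ) : ℂ) * Complex.I =
          τ * Complex.I / (Real.sqrt (N i) : ℂ) := by push_cast; ring
      have e2 : c * (N i : ℝ) * (τ / Real.sqrt (N i)) ^ 2 = c * τ ^ 2 := by
        rw [div_pow, Real.sq_sqrt (Nat.cast_nonneg _)]
        have : (N i : ℝ) ≠ 0 := fun h => hsi.ne' (by rw [h, Real.sqrt_zero])
        field_simp
      rw [e1, e2] at h1
      have e3 : ‖Complex.exp (-(τ * Complex.I * (Real.sqrt (N i) : ℂ)))‖ = 1 := by
        rw [show -(τ * Complex.I * (Real.sqrt (N i) : ℂ)) =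
          ((-(τ * Real.sqrt (N i)) : ℝ) : ℂ) * Complex.I by push_cast; ring,
          Complex.norm_exp_ofReal_mul_I]
      have e4 : ‖Complex.exp ((u i - τ * Complex.I) / (Real.sqrt (N i) : ℂ))‖ =
          Real.exp ((u i).re / Real.sqrt (N i)) := by
        rw [Complex.norm_exp, Complex.div_ofReal_re]; simp
      have h2 : -u₀.re / 2 ≤ ‖(Real.sqrt (N i) : ℂ) *
          (1 - Complex.exp ((u i - τ * Complex.I) / (Real.sqrt (N i) : ℂ)))‖ := by
        refine hi.trans ?_
        rw [norm_mul, Complex.norm_real, Real.norm_of_nonneg hsi.le]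
        refine mul_le_mul_of_nonneg_left ?_ hsi.le
        have := norm_sub_norm_le (1 : ℂ)
          (Complex.exp ((u i - τ * Complex.I) / (Real.sqrt (N i) : ℂ)))
        rwa [norm_one, e4] at this
      rw [norm_div, norm_div, norm_mul, e3, mul_one]
      refine div_le_div₀ (by positivity) ?_ hpos h2
      rw [div_le_iff₀ hG, neg_mul]
      calc _ ≤ _ := h1
        _ = _ := by ring
    · exact ((integrable_exp_neg_mul_sq hc).const_mul C).div_const _
    · refine .of_forall fun τ => ?_
      have h1 := tendsto_local hlam hθ hgrowth hN
        (tendsto_const_nhds (x := (τ * Complex.I : ℂ)) (f := l))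
      have h2 := tendsto_mul_one_sub_exp hs (hu.sub_const (τ * Complex.I))
      have hne : -(u₀ - τ * Complex.I) ≠ 0 := fun h => by
        have := congrArg Complex.re h
        simp at this
        linarith
      refine (h1.div h2 hne).congr' ?_
      filter_upwards [hs.eventually_gt_atTop (|τ| / Real.pi)] with i hi
      rw [div_lt_iff₀ Real.pi_pos, mul_comm] at hi
      simp only [H]
      rw [Set.indicator_of_mem (Set.mem_Ioc.2 ⟨(abs_lt.1 hi).1, (abs_lt.1 hi).2.le⟩)]
      rfl
  rw [← integral_gaussian_div hlam hu₀]
  refine (hmain.const_mul _).congr' ?_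
  filter_upwards [hure.eventually_lt_const hu₀, hs.eventually_gt_atTop 0,
    hN.eventually_gt_atTop 0] with i hui hsi hNi
  have hsc : (Real.sqrt (N i) : ℂ) ≠ 0 := Complex.ofReal_ne_zero.2 hsi.ne'
  have hle : -(Real.pi * Real.sqrt (N i)) ≤ Real.pi * Real.sqrt (N i) := by
    have := mul_pos Real.pi_pos hsi
    linarith
  rw [sub_partialSum_eq_integral hf (scale_pos hlam hNi) hNi (x := u i / (Real.sqrt (N i) : ℂ))
    (by rw [Complex.div_ofReal_re]; exact div_neg_of_neg_of_pos hui hsi) hsi,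
    mul_assoc, mul_div_assoc]
  congr 1
  rw [div_eq_mul_inv _ (modelAtScale a b lam (N i)),
    ← intervalIntegral.integral_mul_const, ← intervalIntegral.integral_mul_const,
    intervalIntegral.integral_of_le hle, ← MeasureTheory.integral_indicator measurableSet_Ioc]
  refine MeasureTheory.integral_congr_ae (.of_forall fun τ => ?_)
  simp only [H]
  congr 1
  ext τ
  have hNs : (N i : ℂ) = (Real.sqrt (N i) : ℂ) ^ 2 := by
    rw [← Complex.ofReal_pow, Real.sq_sqrt (Nat.cast_nonneg _), Complex.ofReal_natCast]
  have e1 : ((τ / Real.sqrt (N i) : ℝ) : ℂ) * Complex.I =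
      τ * Complex.I / (Real.sqrt (N i) : ℂ) := by push_cast; ring
  have e2 : (N i : ℂ) * (u i / (Real.sqrt (N i) : ℂ) - τ * Complex.I / (Real.sqrt (N i) : ℂ)) =
      u i * (Real.sqrt (N i) : ℂ) + -(τ * Complex.I * (Real.sqrt (N i) : ℂ)) := by
    rw [hNs]; field_simp; ring
  rw [e1, e2, Complex.exp_add, ← sub_div, Complex.exp_neg (u i * _)]
  have h1 := Complex.exp_ne_zero (u i * (Real.sqrt (N i) : ℂ))
  field_simp

/-! ### The limit of `p_{n-1} / f` -/

lemma tendsto_mul_log_one_add_div {ι : Type*} {l : Filter ι} {s : ι → ℝ}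
    (hs : Tendsto s l atTop) {v : ι → ℂ} {v₀ : ℂ} (hv : Tendsto v l (𝓝 v₀)) :
    Tendsto (fun i => (s i : ℂ) * Complex.log (1 + v i / s i)) l (𝓝 v₀) := by
  have hsinv := tendsto_inv_atTop_zero.comp hs
  have hbound : Tendsto (fun i => ‖v i‖ ^ 2 * (s i)⁻¹) l (𝓝 0) := by
    simpa using (hv.norm.pow 2).mul hsinv
  have hsmall : Tendsto (fun i => ‖v i‖ * (s i)⁻¹) l (𝓝 0) := by
    simpa using hv.norm.mul hsinv
  have hdiff : Tendsto (fun i => (s i : ℂ) * Complex.log (1 + v i / s i) - v i) l (𝓝 0) := by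
    refine squeeze_zero_norm' ?_ hbound
    filter_upwards [hs.eventually_gt_atTop 0,
      hsmall.eventually_lt_const (show (0 : ℝ) < 1 / 2 by norm_num)] with i hs0 hi
    have hsc : (s i : ℂ) ≠ 0 := Complex.ofReal_ne_zero.2 hs0.ne'
    set y : ℂ := v i / s i with hy
    have hyn : ‖y‖ = ‖v i‖ * (s i)⁻¹ := by
      rw [hy, norm_div, Complex.norm_real, Real.norm_of_nonneg hs0.le, div_eq_mul_inv]
    have hy2 : ‖y‖ < 1 / 2 := by rw [hyn]; exact hi
    have key := Complex.norm_log_one_add_sub_self_le (z := y) (by linarith)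
    have hinv : (1 - ‖y‖)⁻¹ ≤ 2 := by
      rw [inv_le_comm₀ (by linarith) two_pos]; linarith
    have key2 : ‖Complex.log (1 + y) - y‖ ≤ ‖y‖ ^ 2 := by
      refine key.trans ?_
      have := mul_le_mul_of_nonneg_left hinv (sq_nonneg ‖y‖)
      linarith
    have e : (s i : ℂ) * Complex.log (1 + y) - v i = s i * (Complex.log (1 + y) - y) := by
      rw [show v i = y * s i by rw [hy]; field_simp]; ring
    rw [e, norm_mul, Complex.norm_real, Real.norm_of_nonneg hs0.le]
    calc s i * ‖Complex.log (1 + y) - y‖ ≤ s i * ‖y‖ ^ 2 := by gcongr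
      _ = ‖v i‖ ^ 2 * (s i)⁻¹ := by rw [hyn]; field_simp
  simpa using hdiff.add hv

/-- The points `r_n * (1 + w / √n)` in logarithmic coordinates. -/
lemma exists_log_coordinate {ι : Type*} {l : Filter ι} {N : ι → ℕ} (hN : Tendsto N l atTop)
    {w : ι → ℂ} {w₀ : ℂ} (hw : Tendsto w l (𝓝 w₀)) :
    ∃ u : ι → ℂ, Tendsto u l (𝓝 w₀) ∧ ∀ᶠ i in l,
      Complex.exp (u i / (Real.sqrt (N i) : ℂ)) = 1 + w i / (Real.sqrt (N i) : ℂ) := by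
  have hs : Tendsto (fun i => Real.sqrt (N i)) l atTop :=
    Real.tendsto_sqrt_atTop.comp (tendsto_natCast_atTop_atTop.comp hN)
  refine ⟨_, tendsto_mul_log_one_add_div hs hw, ?_⟩
  have hsmall : Tendsto (fun i => ‖w i‖ * (Real.sqrt (N i))⁻¹) l (𝓝 0) := by
    simpa using hw.norm.mul (tendsto_inv_atTop_zero.comp hs)
  filter_upwards [hs.eventually_gt_atTop 0, hsmall.eventually_lt_const one_pos] with i hs0 hi
  have hsc : (Real.sqrt (N i) : ℂ) ≠ 0 := Complex.ofReal_ne_zero.2 hs0.ne'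
  rw [mul_div_cancel_left₀ _ hsc, Complex.exp_log]
  intro h
  have h1 := congrArg norm (eq_neg_of_add_eq_zero_right h)
  rw [norm_neg, norm_one, norm_div, Complex.norm_real, Real.norm_of_nonneg hs0.le,
    div_eq_mul_inv] at h1
  exact hi.ne h1

lemma eventually_ne_zero {f : ℂ → ℂ} {a b : ℂ} {lam θ μ : ℝ} (hlam : 0 < lam) (hθ : 0 < θ)
    (hgrowth : HasSectorGrowth f a b lam θ μ) {ι : Type*} {l : Filter ι} {N : ι → ℕ}
    (hN : Tendsto N l atTop) {w : ι → ℂ} {w₀ : ℂ} (hw : Tendsto w l (𝓝 w₀)) :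
    ∀ᶠ i in l, f (scale lam (N i) * (1 + w i / (Real.sqrt (N i) : ℂ))) ≠ 0 := by
  obtain ⟨u, hu, hexp⟩ := exists_log_coordinate hN hw
  filter_upwards [hexp, (tendsto_local hlam hθ hgrowth hN hu).eventually_ne
    (Complex.exp_ne_zero _)] with i hi hne h
  rw [hi, h] at hne
  simp at hne

lemma tendsto_partialSum_div {f : ℂ → ℂ} (hf : Differentiable ℂ f) {a b : ℂ} {lam θ μ : ℝ}
    (hlam : 0 < lam) (hθ : 0 < θ) (hθ' : θ < min Real.pi (Real.pi / lam)) (hμ : μ < 1)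
    (hgrowth : HasSectorGrowth f a b lam θ μ) {ι : Type*} {l : Filter ι}
    [l.IsCountablyGenerated] {N : ι → ℕ} (hN : Tendsto N l atTop) {w : ι → ℂ} {w₀ : ℂ}
    (hw : Tendsto w l (𝓝 w₀)) (hw₀ : w₀.re < 0) :
    Tendsto (fun i => partialSum f (N i - 1)
        (scale lam (N i) * (1 + w i / (Real.sqrt (N i) : ℂ))) /
        f (scale lam (N i) * (1 + w i / (Real.sqrt (N i) : ℂ)))) l
      (𝓝 (1 / 2 * erfc (w₀ * (Real.sqrt (lam / 2) : ℂ)))) := by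
  obtain ⟨u, hu, hexp⟩ := exists_log_coordinate hN hw
  have h1 := tendsto_local hlam hθ hgrowth hN hu
  have h2 := tendsto_remainder hf hlam hθ hθ' hμ hgrowth hN hu hw₀
  have hE := Complex.exp_ne_zero (lam * w₀ ^ 2 / 2)
  have h3 := (h2.div h1 hE).const_sub 1
  rw [mul_div_cancel_left₀ _ hE] at h3
  have e : 1 - 1 / 2 * erfc (-(w₀ * (Real.sqrt (lam / 2) : ℂ))) =
      1 / 2 * erfc (w₀ * (Real.sqrt (lam / 2) : ℂ)) := by
    linear_combination (-1 / 2 : ℂ) * erfc_add_erfc_neg (w₀ * (Real.sqrt (lam / 2) : ℂ))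
  rw [e] at h3
  refine h3.congr' ?_
  filter_upwards [hexp, eventually_ne_zero hlam hθ hgrowth hN hw,
    ((tendsto_scale hlam).comp hN).eventually_gt_atTop 1] with i hi hne hr
  have hG := modelAtScale_ne_zero a b hr
  have hE1 := Complex.exp_ne_zero (-(u i * (Real.sqrt (N i) : ℂ)))
  simp only [Pi.div_apply]
  rw [hi]
  set z : ℂ := scale lam (N i) * (1 + w i / (Real.sqrt (N i) : ℂ))
  field_simp
  ring

lemma tendstoLocallyUniformlyOn_of_tendsto_prod {ι : Type*} {l : Filter ι} {F : ι → ℂ → ℂ}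
    {g : ℂ → ℂ} {U : Set ℂ} (hg : Continuous g)
    (h : ∀ w ∈ U, Tendsto (fun q : ι × ℂ => F q.1 q.2) (l ×ˢ 𝓝 w) (𝓝 (g w))) :
    TendstoLocallyUniformlyOn F g l U := by
  rw [tendstoLocallyUniformlyOn_iff_filter]
  intro w hw
  rw [tendstoUniformlyOnFilter_iff_tendsto]
  have h1 : Tendsto (fun q : ι × ℂ => g q.2) (l ×ˢ 𝓝[U] w) (𝓝 (g w)) :=
    (hg.tendsto w).comp (tendsto_snd.mono_right nhdsWithin_le_nhds)
  have h2 := (h w hw).mono_left (prod_mono_right l (nhdsWithin_le_nhds (s := U)))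
  exact (h1.prodMk_nhds h2).mono_right (nhds_le_uniformity (g w))

/-! ### The complementary error function is entire -/

lemma differentiable_erfc : Differentiable ℂ erfc := by
  intro z₀
  set M := ‖z₀‖ + 1 with hM
  have hbound : MeasureTheory.Integrable (fun t : ℝ =>
      Real.exp (-1 * t ^ 2 + (2 * M + 1) * t + (M ^ 2 + M)) * 2)
      (MeasureTheory.volume.restrict (Set.Ioi 0)) := by
    have h := (integrable_cexp_quadratic' (b := ((-1 : ℝ) : ℂ)) (by simp)
      ((2 * M + 1 : ℝ) : ℂ) ((M ^ 2 + M : ℝ) : ℂ)).norm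
    refine MeasureTheory.Integrable.restrict (MeasureTheory.Integrable.mul_const
      (h.congr (.of_forall fun t => ?_)) _)
    simp only
    rw [Complex.norm_exp]
    congr 1
    norm_cast
  have key := hasDerivAt_integral_of_dominated_loc_of_deriv_le
    (μ := MeasureTheory.volume.restrict (Set.Ioi (0 : ℝ))) (x₀ := z₀)
    (F := fun z t => Complex.exp (-(z + (t : ℂ)) ^ 2))
    (F' := fun z t => Complex.exp (-(z + (t : ℂ)) ^ 2) * (-(2 * (z + t))))
    (Metric.ball_mem_nhds z₀ one_pos)
    (.of_forall fun z => (integrable_erfc_integrand z).restrict.aestronglyMeasurable)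
    (integrable_erfc_integrand z₀).restrict
    (by refine Continuous.aestronglyMeasurable ?_; fun_prop)
    (by
      filter_upwards [MeasureTheory.ae_restrict_mem measurableSet_Ioi] with t ht z hz
      have ht0 : (0 : ℝ) < t := ht
      have hzM : ‖z‖ ≤ M := by
        have h1 : ‖z - z₀‖ < 1 := by simpa [dist_eq_norm] using hz
        have h2 := norm_le_norm_add_norm_sub' z z₀
        linarith
      have hM0 : 0 ≤ M := (norm_nonneg z).trans hzM
      have hre : (-(z + (t : ℂ)) ^ 2).re ≤ -1 * t ^ 2 + 2 * M * t + M ^ 2 := by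
        have e : (-(z + (t : ℂ)) ^ 2).re = -(z.re + t) ^ 2 + z.im ^ 2 := by
          simp [sq]; ring
        have h1 := (abs_le.1 ((Complex.abs_re_le_norm z).trans hzM)).1
        have h2 : z.im ^ 2 ≤ M ^ 2 :=
          sq_le_sq' (abs_le.1 ((Complex.abs_im_le_norm z).trans hzM)).1
            (abs_le.1 ((Complex.abs_im_le_norm z).trans hzM)).2
        rw [e]
        nlinarith [mul_le_mul_of_nonneg_right h1 ht0.le, sq_nonneg z.re]
      have hfac : ‖-(2 * (z + (t : ℂ)))‖ ≤ 2 * Real.exp (M + t) := by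
        rw [norm_neg, norm_mul]
        have h1 : ‖z + (t : ℂ)‖ ≤ M + t := by
          refine (norm_add_le _ _).trans ?_
          rw [Complex.norm_real, Real.norm_of_nonneg ht0.le]
          linarith
        have h2 := Real.add_one_le_exp (M + t)
        have h3 : ‖(2 : ℂ)‖ = 2 := by simp
        rw [h3]
        linarith
      rw [norm_mul, Complex.norm_exp]
      calc Real.exp (-(z + (t : ℂ)) ^ 2).re * ‖-(2 * (z + (t : ℂ)))‖
          ≤ Real.exp (-1 * t ^ 2 + 2 * M * t + M ^ 2) * (2 * Real.exp (M + t)) := by gcongr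
        _ = _ := by
          rw [mul_left_comm, ← Real.exp_add, mul_comm]
          congr 2; ring)
    hbound
    (.of_forall fun t z _ => by
      have h1 : HasDerivAt (fun z : ℂ => -(z + (t : ℂ)) ^ 2) (-(2 * (z + t))) z := by
        have h2 := (((hasDerivAt_id z).add_const (t : ℂ)).fun_pow 2).fun_neg
        simpa using h2
      exact h1.cexp)
  exact (key.2.const_mul _).differentiableAt

/-! ### Persistence of zeros under locally uniform limits -/

/-- The existence part of Hurwitz' theorem. The zeros are found arbitrarily close to the zero of
the limit, which is expressed by the property `P`. -/
lemma eventually_exists_zero {ι : Type*} {l : Filter ι} {F : ι → ℂ → ℂ} {g : ℂ → ℂ} {U : Set ℂ}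
    (hU : IsOpen U) (hlim : TendstoLocallyUniformlyOn F g l U) {w₀ : ℂ} (hw₀ : w₀ ∈ U)
    (hg : Continuous g) (hg₀ : g w₀ = 0) (hne : ∀ᶠ w in 𝓝[≠] w₀, g w ≠ 0)
    (hF : ∀ᶠ q : ι × ℂ in l ×ˢ 𝓝 w₀, DifferentiableAt ℂ (F q.1) q.2)
    {P : ι → ℂ → Prop} (hP : ∀ᶠ q : ι × ℂ in l ×ˢ 𝓝 w₀, P q.1 q.2) :
    ∀ᶠ i in l, ∃ w, P i w ∧ F i w = 0 := by
  obtain ⟨pa, hpa, pb, hpb, hab⟩ := eventually_prod_iff.1 (hF.and hP)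
  have hnear : ∀ᶠ w in 𝓝 w₀, w ∈ U ∧ pb w ∧ (w ≠ w₀ → g w ≠ 0) :=
    (hU.eventually_mem hw₀).and (hpb.and (eventually_nhdsWithin_iff.1 hne))
  obtain ⟨r, hr, hball⟩ := Metric.nhds_basis_closedBall.eventually_iff.1 hnear
  obtain ⟨z₁, hz₁, hmin⟩ := (isCompact_sphere w₀ r).exists_isMinOn
    (NormedSpace.sphere_nonempty.2 hr.le) (hg.norm.continuousOn)
  set m := ‖g z₁‖ with hm
  have hm0 : 0 < m := norm_pos_iff.2 ((hball (Metric.sphere_subset_closedBall hz₁)).2.2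
    (Metric.ne_of_mem_sphere hz₁ hr.ne'))
  have hunif := (tendstoLocallyUniformlyOn_iff_forall_isCompact hU).1 hlim
    (Metric.closedBall w₀ r) (fun w hw => (hball hw).1) (isCompact_closedBall w₀ r)
  filter_upwards [hpa, Metric.tendstoUniformlyOn_iff.1 hunif (m / 4) (by positivity)] with i hi hclose
  by_contra! hno
  have hnz : ∀ w ∈ Metric.closedBall w₀ r, F i w ≠ 0 := fun w hw =>
    hno w (hab hi (hball hw).2.1).2
  have hdiff : DiffContOnCl ℂ (F i) (Metric.ball w₀ r) :=
    DifferentiableOn.diffContOnCl fun w hw =>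
      (hab hi (hball (Metric.closure_ball_subset_closedBall hw)).2.1).1.differentiableWithinAt
  -- The maximum principle for `1 / F i`, which is small on the circle and large at the centre.
  have hmax := Complex.norm_le_of_forall_mem_frontier_norm_le Metric.isBounded_ball
    (hdiff.inv fun w hw => hnz w (Metric.closure_ball_subset_closedBall hw))
    (C := 4 / (3 * m)) (fun w hw => ?_) (subset_closure (Metric.mem_ball_self hr))
  · have h0 := hclose w₀ (Metric.mem_closedBall_self hr.le)
    rw [hg₀, dist_zero_left] at h0
    have hpos : 0 < ‖F i w₀‖ := norm_pos_iff.2 (hnz w₀ (Metric.mem_closedBall_self hr.le))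
    rw [Pi.inv_apply, norm_inv, inv_le_iff_one_le_mul₀ hpos] at hmax
    have : 4 / (3 * m) * ‖F i w₀‖ < 4 / (3 * m) * (m / 4) := by gcongr
    have e : 4 / (3 * m) * (m / 4) = 1 / 3 := by field_simp
    linarith
  · rw [frontier_ball w₀ hr.ne'] at hw
    have h1 : m ≤ ‖g w‖ := hmin hw
    have h2 := hclose w (Metric.sphere_subset_closedBall hw)
    rw [dist_eq_norm] at h2
    have h3 := norm_le_norm_add_norm_sub' (g w) (F i w)
    have h4 : 3 * m / 4 ≤ ‖F i w‖ := by linarith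
    rw [Pi.inv_apply, norm_inv, show 4 / (3 * m) = (3 * m / 4)⁻¹ by field_simp]
    exact inv_anti₀ (by positivity) h4

/-! ### Zeros of the complementary error function -/

lemma norm_erfc_mul_sub_one_le {u : ℂ} (hu : 0 < u.re) :
    ‖(Real.sqrt Real.pi : ℂ) * u * Complex.exp (u ^ 2) * erfc u - 1‖ ≤ 4 * ‖u‖ / u.re ^ 3 := by
  have hu0 : u ≠ 0 := fun h => by simp [h] at hu
  have hpc : (Real.sqrt Real.pi : ℂ) ≠ 0 :=
    Complex.ofReal_ne_zero.2 (Real.sqrt_pos.2 Real.pi_pos).ne'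
  have hre : (-2 * u).re < 0 := by simp; linarith
  have hint1 := integrableOn_exp_mul_complex_Ioi hre 0
  have hone : 2 * u * (∫ t in Set.Ioi (0 : ℝ), Complex.exp (-2 * u * t)) = 1 := by
    rw [integral_exp_mul_complex_Ioi hre 0, Complex.ofReal_zero, mul_zero, Complex.exp_zero]
    field_simp
  have hint2 : MeasureTheory.IntegrableOn
      (fun t : ℝ => Complex.exp (u ^ 2) * Complex.exp (-(u + (t : ℂ)) ^ 2)) (Set.Ioi 0) :=
    ((integrable_erfc_integrand u).const_mul _).integrableOn
  have e : (Real.sqrt Real.pi : ℂ) * u * Complex.exp (u ^ 2) * erfc u - 1 =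
      2 * u * ∫ t in Set.Ioi (0 : ℝ), (Complex.exp (u ^ 2) * Complex.exp (-(u + (t : ℂ)) ^ 2) -
        Complex.exp (-2 * u * t)) := by
    rw [MeasureTheory.integral_sub hint2 hint1, mul_sub, hone,
      MeasureTheory.integral_const_mul, erfc]
    field_simp
  have hbound := MeasureTheory.norm_integral_le_of_norm_le
    (μ := MeasureTheory.volume.restrict (Set.Ioi (0 : ℝ)))
    (f := fun t : ℝ => Complex.exp (u ^ 2) * Complex.exp (-(u + (t : ℂ)) ^ 2) -
        Complex.exp (-2 * u * t)) (g := fun t => 2 / u.re ^ 2 * Real.exp (-u.re * t))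
    ((integrableOn_exp_mul_Ioi (neg_lt_zero.2 hu) 0).const_mul _)
    (by
      filter_upwards [MeasureTheory.ae_restrict_mem measurableSet_Ioi] with t ht
      have ht0 : (0 : ℝ) < t := ht
      have e1 : Complex.exp (u ^ 2) * Complex.exp (-(u + (t : ℂ)) ^ 2) - Complex.exp (-2 * u * t) =
          Complex.exp (-2 * u * t) * ((Real.exp (-t ^ 2) - 1 : ℝ) : ℂ) := by
        rw [← Complex.exp_add, show u ^ 2 + -(u + (t : ℂ)) ^ 2 = -2 * u * t + -(t : ℂ) ^ 2 by ring,
          Complex.exp_add]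
        push_cast
        ring
      have h1 : |Real.exp (-t ^ 2) - 1| ≤ t ^ 2 := by
        rw [abs_sub_comm, abs_of_nonneg (by
          have := Real.exp_le_one_iff.2 (show -t ^ 2 ≤ 0 by nlinarith)
          linarith)]
        have := Real.one_sub_le_exp_neg (t ^ 2)
        linarith
      have h2 : t ^ 2 ≤ 2 / u.re ^ 2 * Real.exp (u.re * t) := by
        have := Real.quadratic_le_exp_of_nonneg (mul_nonneg hu.le ht0.le)
        have h3 : (u.re * t) ^ 2 / 2 ≤ Real.exp (u.re * t) := by
          have := mul_nonneg hu.le ht0.le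
          linarith
        calc t ^ 2 = 2 / u.re ^ 2 * ((u.re * t) ^ 2 / 2) := by field_simp
          _ ≤ _ := by gcongr
      have e2 : (-2 * u * (t : ℂ)).re = -u.re * t + -(u.re * t) := by
        simp; ring
      rw [e1, norm_mul, Complex.norm_exp, Complex.norm_real, Real.norm_eq_abs, e2, Real.exp_add]
      calc Real.exp (-u.re * t) * Real.exp (-(u.re * t)) * |Real.exp (-t ^ 2) - 1|
          ≤ Real.exp (-u.re * t) * Real.exp (-(u.re * t)) *
            (2 / u.re ^ 2 * Real.exp (u.re * t)) := by
            gcongr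
            exact h1.trans h2
        _ = _ := by
            rw [Real.exp_neg (u.re * t)]
            have := Real.exp_ne_zero (u.re * t)
            field_simp)
  rw [MeasureTheory.integral_const_mul, integral_exp_mul_Ioi (neg_lt_zero.2 hu), mul_zero,
    Real.exp_zero] at hbound
  have h2 : ‖(2 : ℂ)‖ = 2 := by simp
  rw [e, norm_mul, norm_mul, h2]
  calc 2 * ‖u‖ * _ ≤ 2 * ‖u‖ * (2 / u.re ^ 2 * (-1 / -u.re)) := by gcongr
    _ = 4 * ‖u‖ / u.re ^ 3 := by field_simp; ring

/-- The correction to `x * (1 + i)` for which `(x * (1 + i) + δ) ^ 2` is approximately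
`2 i x ^ 2 + t - log (2 √π x (1 + i))`. -/
noncomputable def erfcShift (x : ℝ) (t : ℂ) : ℂ :=
  (t - Real.log x - Complex.log (2 * Real.sqrt Real.pi * (1 + Complex.I))) /
    (2 * (x * (1 + Complex.I)))

lemma one_add_I_ne_zero : (1 + Complex.I : ℂ) ≠ 0 := fun h => by
  have := congrArg Complex.re h
  simp at this

lemma tendsto_erfcShift {ι : Type*} {l : Filter ι} {X : ι → ℝ} (hX : Tendsto X l atTop)
    {t : ι → ℂ} {t₀ : ℂ} (ht : Tendsto t l (𝓝 t₀)) :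
    Tendsto (fun i => erfcShift (X i) (t i)) l (𝓝 0) := by
  have h1 : Tendsto (fun i => ((X i)⁻¹ : ℂ)) l (𝓝 0) := by
    have := (Complex.continuous_ofReal.tendsto _).comp (tendsto_inv_atTop_zero.comp hX)
    simpa [Function.comp_def] using this
  have h2 : Tendsto (fun i => ((Real.log (X i) / X i : ℝ) : ℂ)) l (𝓝 0) := by
    have := (Complex.continuous_ofReal.tendsto _).comp
      ((Real.isLittleO_log_id_atTop.tendsto_div_nhds_zero).comp hX)
    simpa [Function.comp_def] using this
  have h3 := (((ht.mul h1).sub h2).sub (h1.const_mul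
    (Complex.log (2 * Real.sqrt Real.pi * (1 + Complex.I))))).div_const (2 * (1 + Complex.I))
  simp only [mul_zero, sub_zero, zero_div] at h3
  refine h3.congr' ?_
  filter_upwards [hX.eventually_gt_atTop 0] with i hi
  have hXc : (X i : ℂ) ≠ 0 := Complex.ofReal_ne_zero.2 hi.ne'
  have := one_add_I_ne_zero
  rw [erfcShift]
  push_cast
  field_simp

lemma eventually_re_erfcPoint {ι : Type*} {l : Filter ι} {X : ι → ℝ} (hX : Tendsto X l atTop)
    {t : ι → ℂ} {t₀ : ℂ} (ht : Tendsto t l (𝓝 t₀)) :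
    ∀ᶠ i in l, X i / 2 ≤ (X i * (1 + Complex.I) + erfcShift (X i) (t i)).re ∧
      ‖X i * (1 + Complex.I) + erfcShift (X i) (t i)‖ ≤ 3 * X i := by
  have hδ := (tendsto_erfcShift hX ht).norm
  rw [norm_zero] at hδ
  filter_upwards [hX.eventually_ge_atTop 2, hδ.eventually_lt_const one_pos] with i hi hi'
  constructor
  · have h1 := (abs_le.1 (Complex.abs_re_le_norm (erfcShift (X i) (t i)))).1
    have e : (X i * (1 + Complex.I) + erfcShift (X i) (t i)).re =
        X i + (erfcShift (X i) (t i)).re := by simp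
    rw [e]
    linarith
  · refine (norm_add_le _ _).trans ?_
    rw [norm_mul, Complex.norm_real, Real.norm_of_nonneg (by linarith)]
    have h1 : ‖(1 + Complex.I : ℂ)‖ ≤ 2 := by
      refine (norm_add_le _ _).trans ?_
      rw [norm_one, Complex.norm_I]; norm_num
    have := mul_le_mul_of_nonneg_left h1 (show 0 ≤ X i by linarith)
    linarith

/-- The choice `x = √(π k)` makes `exp (-2 i x ^ 2) = 1`, so that `erfc` has a nontrivial limit
along the points built from `erfcShift`. -/
lemma tendsto_erfc {ι : Type*} {l : Filter ι} {k : ι → ℕ} (hk : Tendsto k l atTop)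
    {t : ι → ℂ} {t₀ : ℂ} (ht : Tendsto t l (𝓝 t₀)) :
    Tendsto (fun i => erfc (Real.sqrt (Real.pi * k i) * (1 + Complex.I) +
      erfcShift (Real.sqrt (Real.pi * k i)) (t i))) l (𝓝 (2 * Complex.exp (-t₀))) := by
  set X : ι → ℝ := fun i => Real.sqrt (Real.pi * k i) with hXdef
  have hX : Tendsto X l atTop := Real.tendsto_sqrt_atTop.comp
    ((tendsto_natCast_atTop_atTop.comp hk).const_mul_atTop Real.pi_pos)
  have hpc : (Real.sqrt Real.pi : ℂ) ≠ 0 :=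
    Complex.ofReal_ne_zero.2 (Real.sqrt_pos.2 Real.pi_pos).ne'
  have hδ := tendsto_erfcShift hX ht
  have hre := eventually_re_erfcPoint hX ht
  set u : ι → ℂ := fun i => X i * (1 + Complex.I) + erfcShift (X i) (t i) with hu
  change Tendsto (fun i => erfc (u i)) l _
  have h1 : Tendsto (fun i => (Real.sqrt Real.pi : ℂ) * u i * Complex.exp (u i ^ 2) * erfc (u i)) l
      (𝓝 1) := by
    rw [tendsto_iff_norm_sub_tendsto_zero]
    have hz : Tendsto (fun i => 96 * ((X i)⁻¹) ^ 2) l (𝓝 0) := by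
      simpa using ((tendsto_inv_atTop_zero.comp hX).pow 2).const_mul 96
    refine squeeze_zero' (.of_forall fun i => norm_nonneg _) ?_ hz
    filter_upwards [hre, hX.eventually_gt_atTop 0] with i hi hXi
    have hpos : 0 < X i / 2 := by linarith
    refine (norm_erfc_mul_sub_one_le (hpos.trans_le hi.1)).trans ?_
    calc 4 * ‖u i‖ / (u i).re ^ 3 ≤ 4 * (3 * X i) / (X i / 2) ^ 3 := by
          gcongr
          exacts [hi.2, hi.1]
      _ = 96 * ((X i)⁻¹) ^ 2 := by field_simp; norm_num
  have h2 : Tendsto (fun i => u i / (X i * (1 + Complex.I))) l (𝓝 1) := by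
    have hinv : Tendsto (fun i => ((X i)⁻¹ : ℂ)) l (𝓝 0) := by
      have := (Complex.continuous_ofReal.tendsto _).comp (tendsto_inv_atTop_zero.comp hX)
      simpa [Function.comp_def] using this
    have h3 := ((hδ.mul hinv).div_const (1 + Complex.I)).const_add 1
    simp only [mul_zero, zero_div, add_zero] at h3
    refine h3.congr' ?_
    filter_upwards [hX.eventually_gt_atTop 0] with i hi
    have hXc : (X i : ℂ) ≠ 0 := Complex.ofReal_ne_zero.2 hi.ne'
    have := one_add_I_ne_zero
    simp only [hu]
    field_simp
  have h3 : Tendsto (fun i => Complex.exp (-t i) * Complex.exp (-erfcShift (X i) (t i) ^ 2)) l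
      (𝓝 (Complex.exp (-t₀))) := by
    have ha := (Complex.continuous_exp.tendsto _).comp ht.neg
    have hb := (Complex.continuous_exp.tendsto _).comp ((hδ.pow 2).neg)
    simpa [Function.comp_def] using ha.mul hb
  have h4 := (h1.mul (h3.const_mul 2)).div h2 one_ne_zero
  rw [one_mul, div_one] at h4
  refine h4.congr' ?_
  filter_upwards [hX.eventually_gt_atTop 0, hre] with i hXi hi
  have hXc : (X i : ℂ) ≠ 0 := Complex.ofReal_ne_zero.2 hXi.ne'
  have hI := one_add_I_ne_zero
  have hui : u i ≠ 0 := fun h => by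
    have h5 : X i / 2 ≤ (u i).re := hi.1
    rw [h, Complex.zero_re] at h5
    linarith
  have hsq : u i ^ 2 = (k i : ℤ) * (2 * Real.pi * Complex.I) + t i - Real.log (X i) -
      Complex.log (2 * Real.sqrt Real.pi * (1 + Complex.I)) + erfcShift (X i) (t i) ^ 2 := by
    have hXX : (X i : ℂ) ^ 2 = Real.pi * k i := by
      rw [← Complex.ofReal_pow, hXdef, Real.sq_sqrt (by positivity)]
      push_cast; ring
    have hprod : 2 * (X i * (1 + Complex.I)) * erfcShift (X i) (t i) = t i - Real.log (X i) -
        Complex.log (2 * Real.sqrt Real.pi * (1 + Complex.I)) := by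
      rw [erfcShift]; field_simp
    have hII : (1 + Complex.I) ^ 2 = 2 * Complex.I := by
      rw [add_sq, Complex.I_sq]; ring
    simp only [hu]
    rw [add_sq, hprod, mul_pow, hXX, hII]
    push_cast
    ring
  have hexp : Complex.exp (u i ^ 2) = Complex.exp (t i) / X i /
      (2 * Real.sqrt Real.pi * (1 + Complex.I)) * Complex.exp (erfcShift (X i) (t i) ^ 2) := by
    rw [hsq, Complex.exp_add, Complex.exp_sub, Complex.exp_sub, Complex.exp_add,
      Complex.exp_int_mul_two_pi_mul_I, one_mul, ← Complex.ofReal_exp, Real.exp_log hXi,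
      Complex.exp_log (mul_ne_zero (mul_ne_zero two_ne_zero hpc) hI)]
  simp only [Pi.div_apply]
  rw [hexp, Complex.exp_neg, Complex.exp_neg]
  have e1 := Complex.exp_ne_zero (t i)
  have e2 := Complex.exp_ne_zero (erfcShift (X i) (t i) ^ 2)
  field_simp

lemma infinite_zeros_erfc : {z : ℂ | erfc z = 0 ∧ z.re < 0}.Infinite := by
  intro hfin
  obtain ⟨B, hB⟩ := (hfin.image norm).bddAbove
  have hXtop : Tendsto (fun k : ℕ => Real.sqrt (Real.pi * k)) atTop atTop :=
    Real.tendsto_sqrt_atTop.comp (tendsto_natCast_atTop_atTop.const_mul_atTop Real.pi_pos)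
  have hlim : TendstoLocallyUniformlyOn (fun (k : ℕ) (t : ℂ) =>
      erfc (Real.sqrt (Real.pi * k) * (1 + Complex.I) + erfcShift (Real.sqrt (Real.pi * k)) t) - 2)
      (fun t => 2 * Complex.exp (-t) - 2) atTop Set.univ :=
    tendstoLocallyUniformlyOn_of_tendsto_prod (by fun_prop) fun t _ =>
      (tendsto_erfc tendsto_fst tendsto_snd).sub_const 2
  have hne : ∀ᶠ t in 𝓝[≠] (0 : ℂ), 2 * Complex.exp (-t) - 2 ≠ 0 := by
    have h : HasDerivAt (fun t : ℂ => 2 * Complex.exp (-t) - 2) (2 * (Complex.exp (-0) * -1)) 0 :=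
      (((hasDerivAt_neg (0 : ℂ)).cexp).const_mul 2).sub_const 2
    exact h.eventually_ne (by simp)
  have hdiff (k : ℕ) : Differentiable ℂ fun t : ℂ =>
      erfc (Real.sqrt (Real.pi * k) * (1 + Complex.I) + erfcShift (Real.sqrt (Real.pi * k)) t)
        - 2 := by
    have := differentiable_erfc
    unfold erfcShift
    fun_prop
  have hz := eventually_exists_zero isOpen_univ hlim (Set.mem_univ 0) (by fun_prop) (by simp) hne
    (.of_forall fun q => (hdiff q.1).differentiableAt)
    (P := fun k t => Real.sqrt (Real.pi * k) / 2 ≤ (Real.sqrt (Real.pi * k) * (1 + Complex.I) +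
        erfcShift (Real.sqrt (Real.pi * k)) t).re ∧
      ‖Real.sqrt (Real.pi * k) * (1 + Complex.I) + erfcShift (Real.sqrt (Real.pi * k)) t‖ ≤
        3 * Real.sqrt (Real.pi * k))
    (eventually_re_erfcPoint (hXtop.comp (tendsto_fst (f := atTop) (g := 𝓝 (0 : ℂ))))
      tendsto_snd)
  obtain ⟨k, ⟨t, ht, h0⟩, hkB, hk0⟩ := (hz.and ((hXtop.eventually_gt_atTop (2 * B)).and
    (hXtop.eventually_gt_atTop 0))).exists
  set u := (Real.sqrt (Real.pi * k) : ℂ) * (1 + Complex.I) +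
    erfcShift (Real.sqrt (Real.pi * k)) t with hu
  have hre : Real.sqrt (Real.pi * k) / 2 ≤ u.re := ht.1
  have hmem : -u ∈ {z : ℂ | erfc z = 0 ∧ z.re < 0} := by
    constructor
    · linear_combination erfc_add_erfc_neg u - h0
    · rw [Complex.neg_re]; linarith
  have h1 := hB (Set.mem_image_of_mem norm hmem)
  rw [norm_neg] at h1
  have h2 := Complex.re_le_norm u
  linarith

lemma eventually_erfc_ne_zero (c w₀ : ℂ) :
    ∀ᶠ w in 𝓝[≠] w₀, 1 / 2 * erfc (w * c) ≠ 0 := by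
  have hd : Differentiable ℂ fun w : ℂ => 1 / 2 * erfc (w * c) := by
    have := differentiable_erfc
    fun_prop
  refine (hd.analyticAt w₀).eventually_eq_zero_or_eventually_ne_zero.resolve_left fun h => ?_
  have h1 := AnalyticOnNhd.eqOn_zero_of_preconnected_of_eventuallyEq_zero
    (fun z _ => hd.analyticAt z) isPreconnected_univ (Set.mem_univ w₀) h (Set.mem_univ 0)
  have h2 := erfc_add_erfc_neg 0
  rw [neg_zero] at h2
  simp only [zero_mul, Pi.zero_apply] at h1
  have : (2 : ℂ) = 0 := by linear_combination 4 * h1 - h2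
  exact two_ne_zero this

/-! ### Zeros of the partial sums near `r_n` -/

lemma finite_zeros_partialSum {f : ℂ → ℂ} {n : ℕ} {z₀ : ℂ} (h : partialSum f n z₀ ≠ 0) :
    {z : ℂ | partialSum f n z = 0}.Finite := by
  let Q : Polynomial ℂ := ∑ k ∈ Finset.range (n + 1),
    Polynomial.C (iteratedDeriv k f 0 / (k.factorial : ℂ)) * Polynomial.X ^ k
  have heval (z : ℂ) : Q.eval z = partialSum f n z := by
    simp [Q, partialSum, Polynomial.eval_finsetSum]
  have hQ : Q ≠ 0 := fun h0 => h (by rw [← heval, h0, Polynomial.eval_zero])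
  refine (Polynomial.finite_setOfPred_isRoot hQ).subset fun z hz => ?_
  change Q.eval z = 0
  rw [heval]
  exact hz

lemma scale_succ_sub_le {lam : ℝ} (hlam : 0 < lam) {n : ℕ} (hn : 0 < n) (hn' : 1 / lam ≤ n) :
    0 ≤ scale lam (n + 1) - scale lam n ∧
      scale lam (n + 1) - scale lam n ≤ scale lam n * (2 / lam / n) := by
  have hn0 : (0 : ℝ) < n := Nat.cast_pos.2 hn
  have hs := scale_pos hlam hn
  have hratio : scale lam (n + 1) = scale lam n * (1 + 1 / (n : ℝ)) ^ (1 / lam) := by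
    rw [scale, scale, ← Real.mul_rpow (by positivity) (by positivity)]
    congr 1
    push_cast
    field_simp
  have h1 : 1 ≤ (1 + 1 / (n : ℝ)) ^ (1 / lam) :=
    Real.one_le_rpow (le_add_of_nonneg_right (by positivity)) (by positivity)
  have h2 : (1 + 1 / (n : ℝ)) ^ (1 / lam) ≤ 1 + 2 / lam / n := by
    have hle : 1 / lam / n ≤ 1 := (div_le_one hn0).2 hn'
    have hx : |1 / lam / n| ≤ 1 := by rwa [abs_of_nonneg (by positivity)]
    have h3 := (abs_le.1 (Real.abs_exp_sub_one_le hx)).2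
    rw [abs_of_nonneg (by positivity)] at h3
    calc (1 + 1 / (n : ℝ)) ^ (1 / lam) ≤ Real.exp (1 / n) ^ (1 / lam) := by
          gcongr
          rw [add_comm]
          exact Real.add_one_le_exp _
      _ = Real.exp (1 / lam / n) := by
          rw [← Real.exp_mul]; congr 1; field_simp
      _ ≤ 1 + 2 * (1 / lam / n) := by linarith
      _ = 1 + 2 / lam / n := by ring
  rw [hratio]
  constructor
  · nlinarith
  · have := mul_le_mul_of_nonneg_left h2 hs.le
    linarith

/-- The points `r_{n+1} * (1 + w / √(n+1))`, with `w` bounded, lie in the disks around `r_n`. -/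
lemma eventually_norm_sub_scale_le {lam ε : ℝ} (hlam : 0 < lam) (hε : 0 < ε) (w₀ : ℂ) :
    ∀ᶠ q : ℕ × ℂ in atTop ×ˢ 𝓝 w₀,
      ‖(scale lam (q.1 + 1) : ℂ) * (1 + q.2 / (Real.sqrt ((q.1 + 1 : ℕ) : ℝ) : ℂ)) -
        (scale lam q.1 : ℂ)‖ ≤ scale lam q.1 * (q.1 : ℝ) ^ (-1 / 2 + ε) := by
  have hpow : ∀ᶠ n : ℕ in atTop, 2 / lam + (1 + 2 / lam) * (‖w₀‖ + 1) ≤ (n : ℝ) ^ ε :=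
    ((tendsto_rpow_atTop hε).comp tendsto_natCast_atTop_atTop).eventually_ge_atTop _
  have hn : ∀ᶠ n : ℕ in atTop, max 1 (1 / lam) ≤ (n : ℝ) :=
    tendsto_natCast_atTop_atTop.eventually_ge_atTop _
  have hw : ∀ᶠ w in 𝓝 w₀, ‖w‖ < ‖w₀‖ + 1 :=
    (continuous_norm.tendsto w₀).eventually_lt_const (lt_add_one _)
  filter_upwards [(hpow.and hn).prod_mk hw] with q ⟨⟨hq1, hq2⟩, hq3⟩
  obtain ⟨n, w⟩ := q
  simp only at hq1 hq2 hq3 ⊢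
  have hn1 : (1 : ℝ) ≤ n := (le_max_left _ _).trans hq2
  have hn0 : (0 : ℝ) < n := one_pos.trans_le hn1
  have hnpos : 0 < n := Nat.cast_pos.1 hn0
  obtain ⟨hd0, hd⟩ := scale_succ_sub_le hlam hnpos ((le_max_right _ _).trans hq2)
  have hs := scale_pos hlam hnpos
  have hs1 := scale_pos hlam (Nat.succ_pos n)
  have hsqrt : 0 < Real.sqrt n := Real.sqrt_pos.2 hn0
  have hsqrt1 : Real.sqrt n ≤ Real.sqrt ((n + 1 : ℕ) : ℝ) :=
    Real.sqrt_le_sqrt (by push_cast; linarith)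
  have hsqn : Real.sqrt n ≤ n := by
    rw [Real.sqrt_le_left hn0.le]
    nlinarith
  have e : (scale lam (n + 1) : ℂ) * (1 + w / (Real.sqrt ((n + 1 : ℕ) : ℝ) : ℂ)) -
      (scale lam n : ℂ) = ((scale lam (n + 1) - scale lam n : ℝ) : ℂ) +
        scale lam (n + 1) * (w / (Real.sqrt ((n + 1 : ℕ) : ℝ) : ℂ)) := by
    push_cast; ring
  have h1 : 2 / lam / (n : ℝ) ≤ 2 / lam / Real.sqrt n := by gcongr
  have h2 : 2 / lam / (n : ℝ) ≤ 2 / lam := div_le_self (by positivity) hn1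
  have h3 : scale lam (n + 1) ≤ scale lam n * (1 + 2 / lam) := by
    have := mul_le_mul_of_nonneg_left h2 hs.le
    linarith
  have hwn : ‖w / (Real.sqrt ((n + 1 : ℕ) : ℝ) : ℂ)‖ ≤ (‖w₀‖ + 1) / Real.sqrt n := by
    rw [norm_div, Complex.norm_real, Real.norm_of_nonneg (Real.sqrt_nonneg _)]
    gcongr
  rw [e]
  refine (norm_add_le _ _).trans ?_
  rw [norm_mul, Complex.norm_real, Complex.norm_real, Real.norm_of_nonneg hd0,
    Real.norm_of_nonneg hs1.le]
  calc scale lam (n + 1) - scale lam n + scale lam (n + 1) *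
        ‖w / (Real.sqrt ((n + 1 : ℕ) : ℝ) : ℂ)‖
      ≤ scale lam n * (2 / lam / Real.sqrt n) +
        scale lam n * (1 + 2 / lam) * ((‖w₀‖ + 1) / Real.sqrt n) := by
        gcongr
        exact hd.trans (by gcongr)
    _ = scale lam n * ((2 / lam + (1 + 2 / lam) * (‖w₀‖ + 1)) / Real.sqrt n) := by ring
    _ ≤ scale lam n * ((n : ℝ) ^ ε / Real.sqrt n) := by gcongr
    _ = scale lam n * (n : ℝ) ^ (-1 / 2 + ε) := by
        rw [Real.rpow_add hn0, neg_div, Real.rpow_neg hn0.le, Real.sqrt_eq_rpow]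
        ring

/-- Every finite set of zeros of the limit function in `Re w < 0` is shadowed, in disjoint
neighbourhoods, by zeros of the rescaled partial sums. -/
lemma tendsto_ncard_zeros {f : ℂ → ℂ} (hf : Differentiable ℂ f) {a b : ℂ} {lam θ μ : ℝ}
    (hlam : 0 < lam) (hθ : 0 < θ) (hθ' : θ < min Real.pi (Real.pi / lam)) (hμ : μ < 1)
    (hgrowth : HasSectorGrowth f a b lam θ μ) {ε : ℝ} (hε : 0 < ε) :
    Tendsto (fun n : ℕ => Set.ncard {z : ℂ | partialSum f n z = 0 ∧
      ‖z - (scale lam n : ℂ)‖ ≤ scale lam n * (n : ℝ) ^ (-1 / 2 + ε)}) atTop atTop := by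
  set q := Real.sqrt (lam / 2) with hq
  have hq0 : 0 < q := Real.sqrt_pos.2 (by positivity)
  have hqc : (q : ℂ) ≠ 0 := Complex.ofReal_ne_zero.2 hq0.ne'
  let pt : ℕ → ℂ → ℂ := fun n w =>
    (scale lam (n + 1) : ℂ) * (1 + w / (Real.sqrt ((n + 1 : ℕ) : ℝ) : ℂ))
  let F : ℕ → ℂ → ℂ := fun n w => partialSum f n (pt n w) / f (pt n w)
  let g : ℂ → ℂ := fun w => 1 / 2 * erfc (w * q)
  let U : Set ℂ := {w | w.re < 0}
  have hU : IsOpen U := isOpen_lt Complex.continuous_re continuous_const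
  have hg : Continuous g := by
    have := differentiable_erfc.continuous
    fun_prop
  have hN (w₀ : ℂ) : Tendsto (fun p : ℕ × ℂ => p.1 + 1) (atTop ×ˢ 𝓝 w₀) atTop :=
    (tendsto_add_atTop_nat 1).comp tendsto_fst
  have hpt (w₀ : ℂ) (hw₀ : w₀ ∈ U) :
      Tendsto (fun p : ℕ × ℂ => F p.1 p.2) (atTop ×ˢ 𝓝 w₀) (𝓝 (g w₀)) :=
    tendsto_partialSum_div hf hlam hθ hθ' hμ hgrowth (hN w₀) tendsto_snd hw₀
  have hfne (w₀ : ℂ) : ∀ᶠ p : ℕ × ℂ in atTop ×ˢ 𝓝 w₀, f (pt p.1 p.2) ≠ 0 :=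
    eventually_ne_zero hlam hθ hgrowth (hN w₀) tendsto_snd
  have hlim : TendstoLocallyUniformlyOn F g atTop U :=
    tendstoLocallyUniformlyOn_of_tendsto_prod hg hpt
  have hgne (w₀ : ℂ) : ∀ᶠ w in 𝓝[≠] w₀, g w ≠ 0 := eventually_erfc_ne_zero _ _
  have hdiff (w₀ : ℂ) : ∀ᶠ p : ℕ × ℂ in atTop ×ˢ 𝓝 w₀, DifferentiableAt ℂ (F p.1) p.2 := by
    filter_upwards [hfne w₀] with p hp
    have h1 : Differentiable ℂ fun w => partialSum f p.1 (pt p.1 w) := by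
      simp only [partialSum, pt]
      fun_prop
    have h2 : Differentiable ℂ fun w => f (pt p.1 w) := by
      simp only [pt]
      fun_prop
    exact (h1 p.2).div (h2 p.2) hp
  have hzeros : {w : ℂ | g w = 0 ∧ w.re < 0}.Infinite := by
    refine Set.Infinite.mono ?_ (infinite_zeros_erfc.image
      (f := fun z : ℂ => z / (q : ℂ)) fun z _ z' _ h => (div_left_inj' hqc).1 h)
    rintro _ ⟨z, ⟨hz, hzre⟩, rfl⟩
    refine ⟨?_, ?_⟩
    · simp only [g]
      rw [div_mul_cancel₀ _ hqc, hz, mul_zero]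
    · simp only
      rw [Complex.div_ofReal_re]
      exact div_neg_of_neg_of_pos hzre hq0
  have hpoly : ∀ᶠ n in atTop, ∃ z, partialSum f n z ≠ 0 := by
    obtain ⟨w₁, hw₁, hgw₁⟩ : ∃ w₁ ∈ U, g w₁ ≠ 0 := by
      have h := (hgne (-1)).and (eventually_nhdsWithin_of_eventually_nhds
        (hU.eventually_mem (show (-1 : ℂ) ∈ U by simp [U])))
      obtain ⟨w₁, h1, h2⟩ := h.exists
      exact ⟨w₁, h2, h1⟩
    have h1 := (hpt w₁ hw₁).comp (tendsto_id.prodMk (tendsto_const_nhds (x := w₁) (f := atTop)))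
    filter_upwards [h1.eventually_ne hgw₁] with n hn
    exact ⟨pt n w₁, fun h0 => hn (by simp [F, h0])⟩
  rw [tendsto_atTop]
  intro M
  obtain ⟨S, hS, hcard⟩ := hzeros.exists_subset_card_eq M
  obtain ⟨V, hV, hdisj⟩ := S.finite_toSet.t2_separation
  have hall : ∀ᶠ n in atTop, ∀ x ∈ S, ∃ w, (w ∈ V x ∧ f (pt n w) ≠ 0 ∧
      ‖pt n w - (scale lam n : ℂ)‖ ≤ scale lam n * (n : ℝ) ^ (-1 / 2 + ε)) ∧ F n w = 0 := by
    rw [Filter.eventually_all_finset]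
    intro x hx
    have hx' := hS hx
    refine eventually_exists_zero hU hlim hx'.2 hg hx'.1 (hgne x) (hdiff x) ?_
    have hVx : ∀ᶠ p : ℕ × ℂ in atTop ×ˢ 𝓝 x, p.2 ∈ V x :=
      tendsto_snd.eventually ((hV x).2.eventually_mem (hV x).1)
    exact hVx.and ((hfne x).and (eventually_norm_sub_scale_le hlam hε x))
  filter_upwards [hall, hpoly] with n hn ⟨z₀, hz₀⟩
  choose! w hw hw0 using hn
  have hinj : Set.InjOn (fun x => pt n (w x)) (S : Set ℂ) := by
    intro x hx y hy hxy
    have hs1 : (scale lam (n + 1) : ℂ) ≠ 0 :=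
      Complex.ofReal_ne_zero.2 (scale_pos hlam n.succ_pos).ne'
    have hs2 : (Real.sqrt ((n + 1 : ℕ) : ℝ) : ℂ) ≠ 0 :=
      Complex.ofReal_ne_zero.2 (Real.sqrt_pos.2 (Nat.cast_pos.2 n.succ_pos)).ne'
    have hww : w x = w y :=
      (div_left_inj' hs2).1 (add_left_cancel (mul_left_cancel₀ hs1 hxy))
    by_contra hne
    exact Set.disjoint_left.1 (hdisj hx hy hne) (hw x hx).1 (hww ▸ (hw y hy).1)
  rw [← hcard, ← Set.ncard_coe_finset, ← hinj.ncard_image]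
  refine Set.ncard_le_ncard ?_ ((finite_zeros_partialSum hz₀).subset fun z hz => hz.1)
  rintro _ ⟨x, hx, rfl⟩
  exact ⟨(div_eq_zero_iff.1 (hw0 x hx)).resolve_right (hw x hx).2.1, (hw x hx).2.2⟩

lemma widthPartB {f : ℂ → ℂ} (hf : Differentiable ℂ f) {a b : ℂ} {lam θ μ : ℝ}
    (hlam : 0 < lam) (hθ : 0 < θ) (hθ' : θ < min Real.pi (Real.pi / lam)) (hμ : μ < 1)
    (hgrowth : HasSectorGrowth f a b lam θ μ) :
    WidthPartB f lam 0 2 {n : ℕ | 0 < n} (scale lam) := by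
  have hpos : {n : ℕ | 0 < n} ∈ (atTop : Filter ℕ) := eventually_gt_atTop 0
  have hfilter : (atTop ⊓ 𝓟 {n : ℕ | 0 < n} : Filter ℕ) = atTop :=
    inf_eq_left.2 (le_principal_iff.2 hpos)
  refine ⟨Set.infinite_of_not_bddAbove ?_, le_rfl, fun n hn => ⟨hn, scale_pos hlam hn⟩, ?_, ?_, ?_⟩
  · rintro ⟨B, hB⟩
    have := hB (show B + 1 ∈ {n : ℕ | 0 < n} from B.succ_pos)
    omega
  · rw [hfilter]
    exact tendsto_scale hlam
  · rw [hfilter]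
    refine IsBigO.of_bound ((1 / lam) ^ (1 / lam)) (.of_forall fun n => le_of_eq ?_)
    rw [Real.norm_of_nonneg (by unfold scale; positivity), Real.norm_of_nonneg (by positivity),
      scale, div_eq_mul_one_div (n : ℝ), Real.mul_rpow (by positivity) (by positivity), mul_comm]
    congr 2
    push_cast
    field_simp
  · intro ε hε
    rw [hfilter]
    refine (tendsto_ncard_zeros hf hlam hθ hθ' hμ hgrowth hε).congr fun n => ?_
    simp

end PartialSums

theorem theorem1 (f : ℂ → ℂ) (hf : Differentiable ℂ f)
    (a b : ℂ) (lam θ μ : ℝ) (hlam : 0 < lam)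
    (hθ : 0 < θ) (hθ' : θ < min Real.pi (Real.pi / lam)) (hμ : μ < 1)
    (hgrowth : PartialSums.HasSectorGrowth f a b lam θ μ)
    (hderiv : PartialSums.LogDerivGrowth f lam θ) :
    (∀ K : Set ℂ, IsCompact K → K ⊆ {w : ℂ | w.re < 0} →
      TendstoUniformlyOn
        (fun (n : ℕ) (w : ℂ) =>
          PartialSums.partialSum f (n - 1)
              ((PartialSums.scale lam n : ℂ) * (1 + w / (Real.sqrt (n : ℝ) : ℂ))) /
            f ((PartialSums.scale lam n : ℂ) * (1 + w / (Real.sqrt (n : ℝ) : ℂ))))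
        (fun w : ℂ => 1 / 2 * PartialSums.erfc (w * (Real.sqrt (lam / 2) : ℂ)))
        atTop K) ∧
    PartialSums.WidthPartB f lam 0 2 {n : ℕ | 0 < n} (PartialSums.scale lam) := by
  refine ⟨fun K hK hKU => ?_, PartialSums.widthPartB hf hlam hθ hθ' hμ hgrowth⟩
  have hU : IsOpen {w : ℂ | w.re < 0} := isOpen_lt Complex.continuous_re continuous_const
  have hcont : Continuous fun w : ℂ =>
      1 / 2 * PartialSums.erfc (w * (Real.sqrt (lam / 2) : ℂ)) := by
    have := PartialSums.differentiable_erfc.continuous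
    fun_prop
  exact (tendstoLocallyUniformlyOn_iff_forall_isCompact hU).1
    (PartialSums.tendstoLocallyUniformlyOn_of_tendsto_prod hcont fun w hw =>
      PartialSums.tendsto_partialSum_div hf hlam hθ hθ' hμ hgrowth tendsto_fst tendsto_snd hw)
    K hKU hK
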